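/- Let $G=(\mathbb V,E)$ be the Rado graph (the countably infinite simple graph with the extension property) and let $\alpha\in[0,1]$. A *Rado-nominal set* is a set with an action of $\mathrm{Aut}(G)$ in which every element $x$ has a finite support, i.e. a finite $A\subseteq\mathbb V$ such that every automorphism fixing $A$ pointwise fixes $x$. For a Rado-nominal set $X$, let $2^X$ be the set of finitely supported subsets of $X$, and let $\mathcal P(X)$ be the Rado-nominal set of finitely supported $\mu:2^X\to[0,1]$ with $\mu(X)=1$ that are countably additive on sequences of disjoint sets having a common finite support. $\mathcal P$ is a strong monad, with the Dirac measures $\eta_X$ as unit and bind $(\mu\mathbin{>\!\!>\!=}k)(S)=\int k(x,S)\,\mu(\mathrm dx)$, where the integral of a finitely supported function is the supremum of the integrals of the finitely supported simple functions below it. Then there is an equivariant $\nu_\alpha\in\mathcal P(\mathbb V)$ such that, for every $S\in 2^{\mathbb V}$, every finite support $A$ of $S$, and every choice of vertices $v_B\in\mathbb V\setminus A$ $(B\subseteq A)$ with $\{a\in A: E(v_B,a)\}=B$, $$\nu_\alpha(S)=\sum_{B\subseteq A}[v_B\in S]\prod_{a\in A}\bigl(\alpha\,[E(v_B,a)]+(1-\alpha)\,[\neg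 E(v_B,a)]\bigr).$$ The least strong submonad $\mathcal P_\alpha$ of $\mathcal P$ containing $\nu_\alpha\in\mathcal P(\mathbb V)$ and all the Bernoulli measures on $2=1+1$ is commutative, so that its Kleisli category $\mathrm{Kl}(\mathcal P_\alpha)$ is a distributive Markov category (a Markov category with chosen finite coproducts over which $\otimes$ distributes and whose injections are deterministic). Interpret in it the typed first-order language with unit, product, empty and sum types, $\mathsf{let}$, a type $\mathsf{vertex}$, and constants $\mathsf{new}:\mathsf{unit}\to\mathsf{vertex}$ and $\mathsf{edge}:\mathsf{vertex}*\mathsf{vertex}\to\mathsf{bool}=\mathsf{unit}+\mathsf{unit}$, by $[\![\mathsf{vertex}]\!]=\mathbb V$, $[\![\mathsf{new}()]\!]=\nu_\alpha$, $[\![\mathsf{edge}]\!](v,w)=\eta(E(v,w))$, and let $t\equiv u$ mean $[\![t]\!]=[\![u]\!]$. Then: 1. $x\vdash\mathsf{edge}(x,x)\equiv\mathsf{false}$, $\;x,y\vdash\mathsf{edge}(x,y)\equiv\mathsf{edge}(y,x)$, and $[\![\mathsf{edge}]\!]$ is deterministic. 2. The theory is Bernoulli-based: there is a faithful functor $\Psi$,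 strictly preserving the distributive Markov structure, to the category $\mathbf{FinStoch}$ of stochastic matrices from the category whose objects are the natural numbers and whose morphisms are those of $\mathrm{Kl}(\mathcal P_\alpha)$ between the numeral objects $0,1,1+1,\dots$; explicitly, $\Psi(f)_{ij}=f(i)(\{j\})$. 3. For every $n$, the closed program $t_n:\mathsf{bool}^{(n^2)}$ given by $$\mathsf{let}\ x_1=\mathsf{new}()\ \mathsf{in}\ \dots\ \mathsf{let}\ x_n=\mathsf{new}()\ \mathsf{in}\ \bigl(\mathsf{edge}(x_i,x_j)\bigr)_{1\le i,j\le n}$$ has, through $\Psi$, the distribution on $n\times n$ matrices of truth values that is concentrated on adjacency matrices of simple undirected graphs and gives the matrix of a graph $g$ on $\{1,\dots,n\}$ the probability $$\int_{[0,1]^n}\ \prod_{i<j,\ ij\in g}W_\alpha(x_i,x_j)\prod_{i<j,\ ij\notin g}\bigl(1-W_\alpha(x_i,x_j)\bigr)\,\mathrm d(x_1,\dots,x_n),$$ where $W_\alpha\equiv\alpha$ is the Erdős–Rényi graphon. -/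

import Mathlib

open CategoryTheory MonoidalCategory MeasureTheory
open scoped ENNReal Pointwise ComonObj

noncomputable section

/-! ### Distributive Markov categories, numerals and Bernoulli bases -/

/-- A distributive Markov category: a Markov category (symmetric monoidal, with terminal monoidal
unit and compatible commutative comonoids) with chosen finite coproducts, over which the
tensor distributes, and whose coproduct injections are deterministic. -/
class DistributiveMarkovCategory (C : Type*) [Category C] [MonoidalCategory C] extends
    MarkovCategory C where
  zero : C
  fromZero (X : C) : zero ⟶ X
  fromZero_uniq {X : C} (f : zero ⟶ X) : f = fromZero X
  coprod : C → C → C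
  inl (X Y : C) : X ⟶ coprod X Y
  inr (X Y : C) : Y ⟶ coprod X Y
  copair {X Y Z : C} (f : X ⟶ Z) (g : Y ⟶ Z) : coprod X Y ⟶ Z
  inl_copair {X Y Z : C} (f : X ⟶ Z) (g : Y ⟶ Z) : inl X Y ≫ copair f g = f
  inr_copair {X Y Z : C} (f : X ⟶ Z) (g : Y ⟶ Z) : inr X Y ≫ copair f g = g
  copair_uniq {X Y Z : C} (h : coprod X Y ⟶ Z) : h = copair (inl X Y ≫ h) (inr X Y ≫ h)
  distrib_isIso (X Y Z : C) :
    IsIso (copair (inl X Y ▷ Z) (inr X Y ▷ Z) : coprod (X ⊗ Z) (Y ⊗ Z) ⟶ coprod X Y ⊗ Z)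
  distrib_zero_isIso (Z : C) : IsIso (fromZero (zero ⊗ Z))
  inl_deterministic (X Y : C) : Deterministic (inl X Y)
  inr_deterministic (X Y : C) : Deterministic (inr X Y)

attribute [instance] DistributiveMarkovCategory.distrib_isIso
  DistributiveMarkovCategory.distrib_zero_isIso


namespace DistributiveMarkovCategory

variable (C : Type*) [Category C] [MonoidalCategory C] [DistributiveMarkovCategory C]

variable {C} in
/-- The distributivity isomorphism. -/
def undistrib (X Y Z : C) : coprod X Y ⊗ Z ⟶ coprod (X ⊗ Z) (Y ⊗ Z) :=
  haveI := distrib_isIso X Y Z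
  inv (copair (inl X Y ▷ Z) (inr X Y ▷ Z))

/-- The numeral objects `0, 1, 1 + 1, 1 + 1 + 1, …`. -/
def num : ℕ → C
  | 0 => zero
  | n + 1 => coprod (num n) (𝟙_ C)

/-- The coproduct injections `1 ⟶ n`. -/
def pt : (n : ℕ) → Fin n → (𝟙_ C ⟶ num C n)
  | 0 => Fin.elim0
  | n + 1 => Fin.lastCases (inr (num C n) (𝟙_ C)) fun i => pt n i ≫ inl (num C n) (𝟙_ C)

variable {C}

/-- The morphism out of a numeral with prescribed components. -/
def caseNum {X : C} : (n : ℕ) → (Fin n → (𝟙_ C ⟶ X)) → (num C n ⟶ X)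
  | 0, _ => fromZero X
  | n + 1, f => copair (caseNum n fun i => f i.castSucc) (f (Fin.last n))

variable (C) in
/-- The morphism of numerals given by a function of finite sets. -/
def ofFun {m n : ℕ} (u : Fin m → Fin n) : num C m ⟶ num C n := caseNum m fun i => pt C n (u i)

/-- Copairing, on numerals. -/
def copairNum {m n : ℕ} {X : C} (f : num C m ⟶ X) (g : num C n ⟶ X) : num C (m + n) ⟶ X :=
  caseNum (m + n) (Fin.addCases (fun i => pt C m i ≫ f) fun j => pt C n j ≫ g)

variable (C) in
/-- The canonical (iso)morphism `mn ⟶ m ⊗ n` of numerals. -/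
def mulNum (m n : ℕ) : num C (m * n) ⟶ num C m ⊗ num C n :=
  caseNum (m * n) fun k => (λ_ (𝟙_ C)).inv ≫
    (pt C m (finProdFinEquiv.symm k).1 ⊗ₘ pt C n (finProdFinEquiv.symm k).2)

variable (C) in
/-- A Bernoulli base: a faithful functor to the category of stochastic matrices, from the category
whose objects are the natural numbers and whose morphisms are the morphisms of `C` between the
corresponding numerals, strictly preserving the distributive Markov structure.  Associators, unitors,
symmetries, copying, discarding and coproduct injections between numerals are all of the form
`ofFun u`, so that `map_ofFun` expresses that they are preserved; the tensor product of `f` and `g`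
in the category of numerals is the `h` of `map_tensor`. -/
structure BernoulliBase where
  map : ∀ {m n : ℕ}, (num C m ⟶ num C n) → Matrix (Fin m) (Fin n) ℝ
  nonneg : ∀ {m n : ℕ} (f : num C m ⟶ num C n) (i : Fin m) (j : Fin n), 0 ≤ map f i j
  row_sum : ∀ {m n : ℕ} (f : num C m ⟶ num C n) (i : Fin m), ∑ j, map f i j = 1
  map_id : ∀ n : ℕ, map (𝟙 (num C n)) = 1
  map_comp : ∀ {l m n : ℕ} (f : num C l ⟶ num C m) (g : num C m ⟶ num C n),
    map (f ≫ g) = map f * map g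
  map_ofFun : ∀ {m n : ℕ} (u : Fin m → Fin n),
    map (ofFun C u) = Matrix.of fun i j => if u i = j then 1 else 0
  map_copair : ∀ {m m' n : ℕ} (f : num C m ⟶ num C n) (g : num C m' ⟶ num C n),
    map (copairNum f g) = Matrix.of (Fin.addCases (map f) (map g))
  map_tensor : ∀ {m n m' n' : ℕ} (f : num C m ⟶ num C n) (g : num C m' ⟶ num C n')
    (h : num C (m * m') ⟶ num C (n * n')),
    mulNum C m m' ≫ (f ⊗ₘ g) = h ≫ mulNum C n n' →
    map h = (Matrix.kroneckerMap (· * ·) (map f) (map g)).submatrix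
      finProdFinEquiv.symm finProdFinEquiv.symm
  faithful : ∀ {m n : ℕ} (f g : num C m ⟶ num C n), map f = map g → f = g

/-- Let `X` be a numeral object up to isomorphism, with points `pts i`.  Then `f : 1 ⟶ X`, regarded
through `Ψ` as a probability distribution on `ι`, is `p`. -/
def BernoulliBase.IsLaw (Ψ : BernoulliBase C) {X : C} {ι : Type*} (pts : ι → (𝟙_ C ⟶ X))
    (f : 𝟙_ C ⟶ X) (p : ι → ℝ) : Prop :=
  ∃ (N : ℕ) (e : ι ≃ Fin N) (_ : IsIso (caseNum N fun k => pts (e.symm k))),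
    ∀ i, Ψ.map (m := 1) (ε[num C 1] ≫ f ≫ inv (caseNum N fun k => pts (e.symm k))) 0 (e i) = p i

end DistributiveMarkovCategory

/-! ### The programming language with the graph interface -/

namespace GraphLang

/-- Types. -/
inductive Ty : Type
  | vertex | unit | empty
  | prod (A B : Ty)
  | sum (A B : Ty)

/-- Typed de Bruijn variables; contexts are lists of types, the most recent variable first. -/
inductive Var : List Ty → Ty → Type
  | here {Γ : List Ty} {A : Ty} : Var (A :: Γ) A
  | there {Γ : List Ty} {A B : Ty} : Var Γ A → Var (B :: Γ) A

/-- Typed terms. -/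
inductive Tm : List Ty → Ty → Type
  | var {Γ : List Ty} {A : Ty} : Var Γ A → Tm Γ A
  | unit {Γ : List Ty} : Tm Γ .unit
  | pair {Γ : List Ty} {A B : Ty} : Tm Γ A → Tm Γ B → Tm Γ (.prod A B)
  | fst {Γ : List Ty} {A B : Ty} : Tm Γ (.prod A B) → Tm Γ A
  | snd {Γ : List Ty} {A B : Ty} : Tm Γ (.prod A B) → Tm Γ B
  | inl {Γ : List Ty} {A B : Ty} : Tm Γ A → Tm Γ (.sum A B)
  | inr {Γ : List Ty} {A B : Ty} : Tm Γ B → Tm Γ (.sum A B)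
  | letIn {Γ : List Ty} {A B : Ty} : Tm Γ A → Tm (A :: Γ) B → Tm Γ B
  | absurd {Γ : List Ty} {B : Ty} : Tm Γ .empty → Tm Γ B
  | case {Γ : List Ty} {A₁ A₂ B : Ty} :
      Tm Γ (.sum A₁ A₂) → Tm (A₁ :: Γ) B → Tm (A₂ :: Γ) B → Tm Γ B
  | new {Γ : List Ty} : Tm Γ .unit → Tm Γ .vertex
  | edge {Γ : List Ty} : Tm Γ (.prod .vertex .vertex) → Tm Γ (.sum .unit .unit)

/-- `bool = unit + unit`. -/
abbrev Ty.bool : Ty := .sum .unit .unit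

/-- The truth values: `false` is the first injection and `true` the second. -/
def boolLit {Γ : List Ty} (b : Bool) : Tm Γ .bool := if b then .inr .unit else .inl .unit

/-- The `n`-fold power of a type. -/
def Ty.pow (A : Ty) : ℕ → Ty
  | 0 => .unit
  | n + 1 => .prod A (A.pow n)

/-- Tuples, as iterated pairs. -/
def tuple {Γ : List Ty} {A : Ty} : (n : ℕ) → (Fin n → Tm Γ A) → Tm Γ (A.pow n)
  | 0, _ => .unit
  | n + 1, f => .pair (f 0) (tuple n fun i => f i.succ)

/-- Matrices. -/
def matrix {Γ : List Ty} (n : ℕ) (f : Fin n → Fin n → Tm Γ .bool) : Tm Γ ((Ty.bool.pow n).pow n) :=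
  tuple n fun i => tuple n (f i)

/-- In a context of `n` vertices, the variables in the order in which they were bound. -/
def vertexVar : (n : ℕ) → Fin n → Var (List.replicate n Ty.vertex) Ty.vertex
  | 0 => Fin.elim0
  | n + 1 => Fin.lastCases Var.here fun i => Var.there (vertexVar n i)

/-- `let x₁ = new() in … let xₙ = new() in t`. -/
def letNew {B : Ty} : (n : ℕ) → Tm (List.replicate n Ty.vertex) B → Tm [] B
  | 0, t => t
  | n + 1, t => letNew n (.letIn (.new .unit) t)

/-- The program `t_n`, building the adjacency matrix of `n` new vertices. -/
def graphProgram (n : ℕ) : Tm [] ((Ty.bool.pow n).pow n) :=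
  letNew n (matrix n fun i j => .edge (.pair (.var (vertexVar n i)) (.var (vertexVar n j))))

end GraphLang

open DistributiveMarkovCategory GraphLang

/-- An interpretation of the graph interface in a distributive Markov category. -/
structure GraphModel (C : Type*) [Category C] [MonoidalCategory C]
    [DistributiveMarkovCategory C] where
  vertex : C
  new : 𝟙_ C ⟶ vertex
  edge : vertex ⊗ vertex ⟶ coprod (𝟙_ C) (𝟙_ C)

namespace GraphModel

variable {C : Type*} [Category C] [MonoidalCategory C] [DistributiveMarkovCategory C]
  (M : GraphModel C)

/-- Interpretation of types. -/
def ty : Ty → C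
  | .vertex => M.vertex
  | .unit => 𝟙_ C
  | .empty => zero
  | .prod A B => ty A ⊗ ty B
  | .sum A B => coprod (ty A) (ty B)

/-- Interpretation of contexts. -/
def ctx : List Ty → C
  | [] => 𝟙_ C
  | A :: Γ => ctx Γ ⊗ M.ty A

/-- Interpretation of variables, as projections. -/
def var : {Γ : List Ty} → {A : Ty} → Var Γ A → (M.ctx Γ ⟶ M.ty A)
  | _, _, .here (Γ := Γ) (A := A) => ε[M.ctx Γ] ▷ M.ty A ≫ (λ_ (M.ty A)).hom
  | _, _, .there (Γ := Γ) (B := B) x => M.ctx Γ ◁ ε[M.ty B] ≫ (ρ_ (M.ctx Γ)).hom ≫ var x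

/-- Interpretation of terms. -/
def tm : {Γ : List Ty} → {A : Ty} → Tm Γ A → (M.ctx Γ ⟶ M.ty A)
  | _, _, .var x => M.var x
  | _, _, .unit (Γ := Γ) => ε[M.ctx Γ]
  | _, _, .pair (Γ := Γ) t u => Δ[M.ctx Γ] ≫ (tm t ⊗ₘ tm u)
  | _, _, .fst (A := A) (B := B) t => tm t ≫ M.ty A ◁ ε[M.ty B] ≫ (ρ_ (M.ty A)).hom
  | _, _, .snd (A := A) (B := B) t => tm t ≫ ε[M.ty A] ▷ M.ty B ≫ (λ_ (M.ty B)).hom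
  | _, _, .inl (A := A) (B := B) t => tm t ≫ inl (M.ty A) (M.ty B)
  | _, _, .inr (A := A) (B := B) t => tm t ≫ inr (M.ty A) (M.ty B)
  | _, _, .letIn (Γ := Γ) t u => Δ[M.ctx Γ] ≫ M.ctx Γ ◁ tm t ≫ tm u
  | _, _, .absurd (B := B) t => tm t ≫ fromZero (M.ty B)
  | _, _, .case (Γ := Γ) (A₁ := A₁) (A₂ := A₂) t u₁ u₂ =>
      Δ[M.ctx Γ] ≫ tm t ▷ M.ctx Γ ≫ undistrib (M.ty A₁) (M.ty A₂) (M.ctx Γ) ≫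
        copair ((β_ (M.ty A₁) (M.ctx Γ)).hom ≫ tm u₁) ((β_ (M.ty A₂) (M.ctx Γ)).hom ≫ tm u₂)
  | _, _, .new t => tm t ≫ M.new
  | _, _, .edge t => tm t ≫ M.edge

/-- The induced equational theory: `Γ ⊢ t ≡ u : A`. -/
def Equates {Γ : List Ty} {A : Ty} (t u : Tm Γ A) : Prop := M.tm t = M.tm u

/-- The graphs are simple and undirected, that is, `x ⊢ edge(x, x) ≡ false` and
`x, y ⊢ edge(x, y) ≡ edge(y, x)`, and `edge` is deterministic. -/
structure IsSimpleUndirected : Prop where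
  irrefl : M.Equates (Γ := [.vertex]) (.edge (.pair (.var .here) (.var .here))) (boolLit false)
  symm : M.Equates (Γ := [.vertex, .vertex])
    (.edge (.pair (.var (.there .here)) (.var .here)))
    (.edge (.pair (.var .here) (.var (.there .here))))
  deterministic : Deterministic M.edge

/-- The random graphs of the theory, observed through the Bernoulli base `Ψ`, are `p`: for every
`n`, the program `t_n` has the law `p n` on `n × n` matrices of truth values. -/
def HasRandomGraphs (Ψ : BernoulliBase C) (p : ∀ n : ℕ, (Fin n → Fin n → Bool) → ℝ) : Prop :=
  ∀ n : ℕ, Ψ.IsLaw (fun a : Fin n → Fin n → Bool => M.tm (matrix (Γ := []) n fun i j => boolLit (a i j)))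
    (M.tm (graphProgram n)) (p n)

end GraphModel

/-! ### Graphons -/

/-- A graphon: a symmetric measurable function `[0,1]² → [0,1]`. -/
structure Graphon where
  W : unitInterval → unitInterval → unitInterval
  measurable : Measurable (Function.uncurry W)
  symm : ∀ x y, W x y = W y x

namespace Graphon

open Classical in
/-- The probability `p_{W,n}(g)` that the random graph on `n` vertices sampled from `W` is `g`
(one factor for each unordered pair of distinct vertices). -/
def graphProb (W : Graphon) (n : ℕ) (g : SimpleGraph (Fin n)) : ℝ :=
  ∫ x : Fin n → unitInterval, ∏ p : Fin n × Fin n with p.1 < p.2,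
    if g.Adj p.1 p.2 then (W.W (x p.1) (x p.2) : ℝ) else 1 - W.W (x p.1) (x p.2)

open Classical in
/-- `p_{W,n}` as a distribution on matrices of truth values, concentrated on adjacency matrices. -/
def matrixLaw (W : Graphon) (n : ℕ) (a : Fin n → Fin n → Bool) : ℝ :=
  if (∀ i, a i i = false) ∧ ∀ i j, a i j = a j i then
    W.graphProb n (SimpleGraph.fromRel fun i j => a i j = true)
  else 0

/-- The Erdős–Rényi graphon `W_α`, constantly equal to `α`. -/
def erdosRenyi (α : unitInterval) : Graphon where
  W _ _ := α
  measurable := measurable_const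
  symm _ _ := rfl

end Graphon

end

open DistributiveMarkovCategory GraphLang

namespace RadoNominal

noncomputable section

/-! ### The Rado graph and Rado-nominal sets -/

/-- `G` is (a presentation of) the Rado graph: a countably infinite simple graph with the
extension property. -/
structure IsRado {V : Type} (G : SimpleGraph V) : Prop where
  countable : Countable V
  infinite : Infinite V
  extension : ∀ A B : Finset V, Disjoint A B →
    ∃ v, v ∉ A ∧ v ∉ B ∧ (∀ a ∈ A, G.Adj v a) ∧ ∀ b ∈ B, ¬ G.Adj v b

/-- The group of automorphisms of a graph. -/
abbrev GAut {V : Type} (G : SimpleGraph V) : Type := G ≃g G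

variable {V : Type} {G : SimpleGraph V}

/-- `σ` fixes the finite set `A` pointwise. -/
def Fixes (σ : GAut G) (A : Finset V) : Prop := ∀ a ∈ A, σ a = a

/-- The finite set `A` supports the element `x`. -/
def Supports (G : SimpleGraph V) {X : Type} [MulAction (GAut G) X] (A : Finset V) (x : X) : Prop :=
  ∀ σ : GAut G, Fixes σ A → σ • x = x

/-- A nominal set over `G` (a Rado-nominal set when `G` is the Rado graph): a set with an action
of the automorphism group of `G`, every element of which has finite support. -/
structure NomSet (G : SimpleGraph V) where
  carrier : Type
  [action : MulAction (GAut G) carrier]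
  finSupp : ∀ x : carrier, ∃ A : Finset V, Supports G A x

instance : CoeSort (NomSet G) Type := ⟨NomSet.carrier⟩

instance (X : NomSet G) : MulAction (GAut G) X := X.action

/-- Equivariance of a function between nominal sets. -/
abbrev Equivariant {X Y : NomSet G} (f : X → Y) : Prop := ∀ (σ : GAut G) (x : X), f (σ • x) = σ • f x

theorem Fixes.mono {σ : GAut G} {A B : Finset V} (h : Fixes σ B) (hAB : A ⊆ B) : Fixes σ A :=
  fun a ha => h a (hAB ha)

theorem Fixes.inv {σ : GAut G} {A : Finset V} (h : Fixes σ A) : Fixes σ⁻¹ A := fun a ha => by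
  have : σ⁻¹ (σ a) = a := RelIso.inv_apply_self σ a
  rwa [h a ha] at this

section
open Classical in
theorem Fixes.of_union_left {σ : GAut G} {A B : Finset V} (h : Fixes σ (A ∪ B)) : Fixes σ A :=
  h.mono Finset.subset_union_left
open Classical in
theorem Fixes.of_union_right {σ : GAut G} {A B : Finset V} (h : Fixes σ (A ∪ B)) : Fixes σ B :=
  h.mono Finset.subset_union_right
end

open Classical in
theorem Fixes.conj {τ σ : GAut G} {A : Finset V} (h : Fixes τ (A.image σ)) :
    Fixes (σ⁻¹ * τ * σ) A := fun a ha => by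
  have h1 : τ (σ a) = σ a := h _ (Finset.mem_image_of_mem _ ha)
  change σ⁻¹ (τ (σ a)) = a
  rw [h1]; exact RelIso.inv_apply_self σ a

open Classical in
theorem supports_smul {X : Type} [MulAction (GAut G) X] {A : Finset V} {x : X}
    (h : Supports G A x) (σ : GAut G) : Supports G (A.image σ) (σ • x) := fun τ hτ => by
  have := h _ hτ.conj
  rw [mul_smul, mul_smul, inv_smul_eq_iff] at this
  exact this

/-- The vertices, as a nominal set. -/
abbrev vertices (G : SimpleGraph V) : NomSet G where
  carrier := V
  action :=
    { smul := fun σ v => σ v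
      one_smul := fun _ => rfl
      mul_smul := fun _ _ _ => rfl }
  finSupp v := ⟨{v}, fun _ h => h v (Finset.mem_singleton_self v)⟩

/-- A set with the discrete action. -/
abbrev disc (G : SimpleGraph V) (A : Type) : NomSet G where
  carrier := A
  action :=
    { smul := fun _ v => v
      one_smul := fun _ => rfl
      mul_smul := fun _ _ _ => rfl }
  finSupp _ := ⟨∅, fun _ _ => rfl⟩

/-- The product, with the coordinatewise action. -/
abbrev prod (X Y : NomSet G) : NomSet G where
  carrier := X × Y
  finSupp p := by
    classical
    obtain ⟨A, hA⟩ := X.finSupp p.1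
    obtain ⟨B, hB⟩ := Y.finSupp p.2
    exact ⟨A ∪ B, fun σ h => Prod.ext (hA σ h.of_union_left) (hB σ h.of_union_right)⟩

/-- The disjoint union. -/
abbrev sum (X Y : NomSet G) : NomSet G where
  carrier := X ⊕ Y
  finSupp p := by
    rcases p with x | y
    · obtain ⟨A, hA⟩ := X.finSupp x
      exact ⟨A, fun σ h => congrArg Sum.inl (hA σ h)⟩
    · obtain ⟨A, hA⟩ := Y.finSupp y
      exact ⟨A, fun σ h => congrArg Sum.inr (hA σ h)⟩

/-! ### Events and internal probability measures -/

/-- The internal powerset `2^X`: the finitely supported subsets. -/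
def Event (X : NomSet G) : Type := {S : Set X // ∃ A : Finset V, Supports G A S}

instance (X : NomSet G) : MulAction (GAut G) (Event X) where
  smul σ S := ⟨σ • S.1, by
    classical
    obtain ⟨A, hA⟩ := S.2
    exact ⟨A.image σ, supports_smul hA σ⟩⟩
  one_smul S := Subtype.ext (one_smul _ S.1)
  mul_smul σ τ S := Subtype.ext (mul_smul σ τ S.1)

/-- The internal powerset as a nominal set. -/
def power (X : NomSet G) : NomSet G where
  carrier := Event X
  finSupp S := by
    obtain ⟨A, hA⟩ := S.2
    exact ⟨A, fun σ h => Subtype.ext (hA σ h)⟩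

@[simp] theorem Event.smul_val {X : NomSet G} (σ : GAut G) (S : Event X) :
    (σ • S).1 = σ • S.1 := rfl

/-- A finitely supported probability measure on `X`: a finitely supported, internally countably
additive function on the internal powerset of total mass `1`.  (Values are taken in `ℝ≥0∞`;
additivity and total mass `1` force them into `[0,1]`.) -/
structure Prob (X : NomSet G) where
  toFun : Event X → ℝ≥0∞
  finSupp : ∃ A : Finset V, ∀ σ : GAut G, Fixes σ A → ∀ S, toFun (σ • S) = toFun S
  /-- Additivity on support-bounded sequences of disjoint events. -/
  additive : ∀ (S : ℕ → Event X) (U : Event X),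
    (∃ A : Finset V, ∀ i, Supports G A (S i).1) →
    Pairwise (fun i j => Disjoint (S i).1 (S j).1) → U.1 = ⋃ i, (S i).1 →
    toFun U = ∑' i, toFun (S i)
  univ : ∀ U : Event X, U.1 = Set.univ → toFun U = 1

theorem Prob.ext' {X : NomSet G} {μ ν : Prob X} (h : ∀ S, μ.toFun S = ν.toFun S) : μ = ν := by
  cases μ; cases ν; congr; exact funext h

/-- The action `(σ • μ)(S) = μ(σ⁻¹ • S)`. -/
instance (X : NomSet G) : MulAction (GAut G) (Prob X) where
  smul σ μ :=
    { toFun := fun S => μ.toFun (σ⁻¹ • S)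
      finSupp := by
        classical
        obtain ⟨A, hA⟩ := μ.finSupp
        refine ⟨A.image σ, fun τ hτ S => ?_⟩
        rw [← hA _ hτ.conj (σ⁻¹ • S)]
        congr 1
        simp only [mul_smul, smul_inv_smul]
      additive := by
        classical
        rintro S U ⟨A, hA⟩ hd hU
        refine μ.additive (fun i => σ⁻¹ • S i) _ ⟨A.image (fun a => σ⁻¹ a), fun i => supports_smul (hA i) _⟩
          (fun i j hij => ?_) ?_
        · exact (Set.disjoint_smul_set).2 (hd hij)
        · rw [Event.smul_val, hU, Set.smul_set_iUnion]; rfl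
      univ := fun U hU => μ.univ _ (by rw [Event.smul_val, hU, Set.smul_set_univ]) }
  one_smul μ := Prob.ext' fun S => by
    change μ.toFun (1⁻¹ • S) = _
    simp
  mul_smul σ τ μ := Prob.ext' fun S => by
    change μ.toFun ((σ * τ)⁻¹ • S) = μ.toFun (τ⁻¹ • σ⁻¹ • S)
    rw [mul_inv_rev, mul_smul]

theorem Prob.smul_toFun {X : NomSet G} (σ : GAut G) (μ : Prob X) (S : Event X) :
    (σ • μ).toFun S = μ.toFun (σ⁻¹ • S) := rfl

/-- `P X`, as a nominal set. -/
def probs (X : NomSet G) : NomSet G where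
  carrier := Prob X
  finSupp μ := by
    obtain ⟨A, hA⟩ := μ.finSupp
    exact ⟨A, fun σ h => Prob.ext' fun S => hA _ h.inv S⟩

/-- Finitely supported numerical functions. -/
def FS {X : NomSet G} (φ : X → ℝ≥0∞) : Prop :=
  ∃ A : Finset V, ∀ σ : GAut G, Fixes σ A → ∀ x, φ (σ • x) = φ x

/-- Finitely supported kernels. -/
def FSK {X Y : NomSet G} (k : X → Prob Y) : Prop :=
  ∃ A : Finset V, ∀ σ : GAut G, Fixes σ A → ∀ x, k (σ • x) = σ • k x

/-! ### Internal integration -/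

theorem supports_set_iff {X : NomSet G} {A : Finset V} {S : Set X} :
    Supports G A S ↔ ∀ σ : GAut G, Fixes σ A → ∀ x, (σ • x ∈ S ↔ x ∈ S) := by
  constructor
  · intro h σ hσ x
    conv_lhs => rw [← h σ hσ]
    exact Set.smul_mem_smul_set_iff
  · intro h σ hσ
    ext x
    rw [Set.mem_smul_set_iff_inv_smul_mem]
    exact h _ hσ.inv x

/-- The `σ`-algebra of the subsets of `X` supported by `A`. -/
abbrev suppAlg (X : NomSet G) (A : Finset V) : MeasurableSpace X where
  MeasurableSet' S := Supports G A S
  measurableSet_empty := supports_set_iff.2 fun _ _ _ => Iff.rfl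
  measurableSet_compl S h := supports_set_iff.2 fun σ hσ x =>
    not_congr (supports_set_iff.1 h σ hσ x)
  measurableSet_iUnion f h := supports_set_iff.2 fun σ hσ x => by
    simp only [Set.mem_iUnion]
    exact exists_congr fun i => supports_set_iff.1 (h i) σ hσ x

theorem suppAlg_mono (X : NomSet G) {A B : Finset V} (h : A ⊆ B) : suppAlg X A ≤ suppAlg X B :=
  fun _ hS σ hσ => hS σ (hσ.mono h)

theorem Prob.empty {X : NomSet G} (μ : Prob X) (U : Event X) (hU : U.1 = ∅) : μ.toFun U = 0 := by
  have hs : Supports G (∅ : Finset V) (∅ : Set X) := (suppAlg X ∅).measurableSet_empty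
  have h1 := μ.additive (fun _ => U) U ⟨∅, fun _ => by rw [hU]; exact hs⟩
    (fun i j _ => by simp [hU]) (by simp [hU])
  have hle : μ.toFun U ≤ 1 := by
    have hu : Supports G (∅ : Finset V) (Set.univ : Set X) := supports_set_iff.2 fun _ _ _ => Iff.rfl
    let T : Event X := ⟨Set.univ, ∅, hu⟩
    have h2 := μ.additive (fun n => if n = 0 then T else U) T
      ⟨∅, fun i => by
        split_ifs
        · exact hu
        · rw [hU]; exact hs⟩
      (fun i j hij => by
        rcases eq_or_ne i 0 with rfl | hi
        · simp [hij.symm, hU]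
        · simp [hi, hU])
      (by
        ext x
        simp only [Set.mem_iUnion]
        exact ⟨fun _ => ⟨0, by simp [T]⟩, fun _ => trivial⟩)
    rw [μ.univ T rfl] at h2
    rw [h2]
    refine le_trans ?_ (ENNReal.le_tsum 1)
    simp
  by_contra h0
  rw [ENNReal.tsum_const_eq_top_of_ne_zero h0] at h1
  rw [h1] at hle
  exact absurd hle (by simp)

/-- The restriction of an internal measure to the events supported by `A` is a measure. -/
def Prob.measure {X : NomSet G} (μ : Prob X) (A : Finset V) : @Measure X (suppAlg X A) :=
  letI := suppAlg X A
  Measure.ofMeasurable (fun S hS => μ.toFun ⟨S, A, hS⟩) (μ.empty _ rfl)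
    (fun f hf hd => μ.additive (fun i => ⟨f i, A, hf i⟩) _ ⟨A, hf⟩ hd rfl)

theorem Prob.measure_apply {X : NomSet G} (μ : Prob X) {A : Finset V} {S : Set X}
    (hS : Supports G A S) : μ.measure A S = μ.toFun ⟨S, A, hS⟩ :=
  @Measure.ofMeasurable_apply X (suppAlg X A) _ _ _ S hS

/-- The internal Lebesgue integral: the supremum of the integrals of all the finitely supported
simple functions below `φ`.  (For each finite `A`, the inner integral is the supremum over the simple
functions built from events supported by `A`.) -/
def Prob.int {X : NomSet G} (μ : Prob X) (φ : X → ℝ≥0∞) : ℝ≥0∞ :=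
  ⨆ A : Finset V, @lintegral X (suppAlg X A) (μ.measure A) φ

theorem Prob.trim {X : NomSet G} (μ : Prob X) {A B : Finset V} (h : A ⊆ B) :
    (μ.measure B).trim (suppAlg_mono X h) = μ.measure A := by
  refine @Measure.ext X (suppAlg X A) _ _ fun S hS => ?_
  rw [trim_measurableSet_eq _ hS, μ.measure_apply (suppAlg_mono X h S hS), μ.measure_apply hS]

theorem measurable_of_supp {X : NomSet G} {φ : X → ℝ≥0∞} {A : Finset V}
    (h : ∀ σ : GAut G, Fixes σ A → ∀ x, φ (σ • x) = φ x) : Measurable[suppAlg X A] φ :=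
  fun S _ => supports_set_iff.2 fun σ hσ x => by
    simp only [Set.mem_preimage, h σ hσ x]

theorem Prob.int_eq {X : NomSet G} (μ : Prob X) {φ : X → ℝ≥0∞} {A : Finset V}
    (h : ∀ σ : GAut G, Fixes σ A → ∀ x, φ (σ • x) = φ x) :
    μ.int φ = @lintegral X (suppAlg X A) (μ.measure A) φ := by
  classical
  refine le_antisymm (iSup_le fun B => ?_) (le_iSup (fun A : Finset V =>
    @lintegral X (suppAlg X A) (μ.measure A) φ) A)
  obtain ⟨g, hg, hle, heq⟩ := @exists_measurable_le_lintegral_eq X (suppAlg X B) (μ.measure B) φ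
  rw [heq, ← μ.trim (Finset.subset_union_right (s₁ := A) (s₂ := B)), lintegral_trim _ hg,
    ← μ.trim (Finset.subset_union_left (s₁ := A) (s₂ := B)),
    lintegral_trim _ (measurable_of_supp h)]
  exact @lintegral_mono X (suppAlg X (A ∪ B)) _ _ _ hle

theorem Prob.int_const {X : NomSet G} (μ : Prob X) (c : ℝ≥0∞) : μ.int (fun _ => c) = c := by
  rw [μ.int_eq (A := ∅) (fun _ _ _ => rfl)]
  have hu : Supports G (∅ : Finset V) (Set.univ : Set X) := supports_set_iff.2 fun _ _ _ => Iff.rfl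
  rw [@lintegral_const X (suppAlg X ∅), μ.measure_apply hu, μ.univ ⟨Set.univ, ∅, hu⟩ rfl, mul_one]

theorem Prob.int_indicator {X : NomSet G} (μ : Prob X) (S : Event X) :
    μ.int (S.1.indicator 1) = μ.toFun S := by
  obtain ⟨A, hA⟩ := S.2
  rw [μ.int_eq (A := A), @lintegral_indicator_one X (suppAlg X A) _ _ hA, μ.measure_apply hA]
  · rfl
  intro σ hσ x
  have := supports_set_iff.1 hA σ hσ x
  by_cases hx : x ∈ S.1
  · rw [Set.indicator_of_mem hx, Set.indicator_of_mem (this.2 hx)]; rfl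
  · rw [Set.indicator_of_notMem hx, Set.indicator_of_notMem (fun h => hx (this.1 h))]

theorem FS.indicator {X : NomSet G} (S : Event X) : FS (S.1.indicator (1 : X → ℝ≥0∞)) := by
  obtain ⟨A, hA⟩ := S.2
  refine ⟨A, fun σ hσ x => ?_⟩
  have := supports_set_iff.1 hA σ hσ x
  by_cases hx : x ∈ S.1
  · rw [Set.indicator_of_mem hx, Set.indicator_of_mem (this.2 hx)]; rfl
  · rw [Set.indicator_of_notMem hx, Set.indicator_of_notMem (fun h => hx (this.1 h))]

theorem Prob.ext_int {X : NomSet G} {μ ν : Prob X} (h : ∀ φ : X → ℝ≥0∞, FS φ → μ.int φ = ν.int φ) :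
    μ = ν := Prob.ext' fun S => by
  rw [← μ.int_indicator, ← ν.int_indicator, h _ (FS.indicator S)]

theorem Prob.smul_int {X : NomSet G} (σ : GAut G) (μ : Prob X) {φ : X → ℝ≥0∞} (hφ : FS φ) :
    (σ • μ).int φ = μ.int (fun x => φ (σ • x)) := by
  classical
  obtain ⟨A, hA⟩ := hφ
  have hA' : ∀ τ : GAut G, Fixes τ (A.image (fun a => σ⁻¹ a)) → ∀ x, φ (σ • τ • x) = φ (σ • x) := by
    intro τ hτ x
    have := hA _ hτ.conj (σ • x)
    simpa [mul_smul] using this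
  rw [(σ • μ).int_eq hA, μ.int_eq hA']
  have hm : Measurable[suppAlg X (A.image (fun a => σ⁻¹ a)), suppAlg X A] (fun x : X => σ • x) := by
    intro S hS
    refine supports_set_iff.2 fun τ hτ x => ?_
    have := supports_set_iff.1 hS _ hτ.conj (σ • x)
    simpa [mul_smul] using this
  rw [← @lintegral_map X X (suppAlg X (A.image (fun a => σ⁻¹ a))) (suppAlg X A) _ φ _ (measurable_of_supp hA) hm]
  congr 1
  refine @Measure.ext X (suppAlg X A) _ _ fun S hS => ?_
  rw [@Measure.map_apply X X (suppAlg X (A.image (fun a => σ⁻¹ a))) (suppAlg X A) _ _ hm _ hS,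
    measure_apply _ hS, measure_apply _ (hm hS)]
  refine congrArg μ.toFun ?_
  refine Subtype.ext ?_
  change σ⁻¹ • S = _
  ext x
  rw [Set.mem_smul_set_iff_inv_smul_mem, inv_inv]; rfl

theorem FSK.apply {X Y : NomSet G} {k : X → Prob Y} {A B : Finset V}
    (hk : ∀ σ : GAut G, Fixes σ A → ∀ x, k (σ • x) = σ • k x) {φ : Y → ℝ≥0∞}
    (hφ : ∀ σ : GAut G, Fixes σ B → ∀ x, φ (σ • x) = φ x)
    {σ : GAut G} (hA : Fixes σ A) (hB : Fixes σ B) (x : X) :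
    (k (σ • x)).int φ = (k x).int φ := by
  rw [hk σ hA, Prob.smul_int _ _ ⟨B, hφ⟩]
  congr 1
  exact funext fun y => hφ σ hB y

theorem FSK.int {X Y : NomSet G} {k : X → Prob Y} (hk : FSK k) {φ : Y → ℝ≥0∞} (hφ : FS φ) :
    FS (fun x => (k x).int φ) := by
  classical
  obtain ⟨A, hA⟩ := hk
  obtain ⟨B, hB⟩ := hφ
  exact ⟨A ∪ B, fun σ h x => FSK.apply hA hB h.of_union_left h.of_union_right x⟩

theorem FSK.toFun {X Y : NomSet G} {k : X → Prob Y} {A B : Finset V}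
    (hk : ∀ σ : GAut G, Fixes σ A → ∀ x, k (σ • x) = σ • k x) {S : Event Y}
    (hS : Supports G B S.1) {σ : GAut G} (hA : Fixes σ A) (hB : Fixes σ B) (x : X) :
    (k (σ • x)).toFun S = (k x).toFun S := by
  rw [hk σ hA, Prob.smul_toFun]
  congr 1
  exact Subtype.ext (hS _ hB.inv)

/-! ### The monad -/

/-- The unit of the monad: the Dirac measure. -/
def dirac {X : NomSet G} (x : X) : Prob X where
  toFun S := S.1.indicator 1 x
  finSupp := by
    obtain ⟨A, hA⟩ := X.finSupp x
    refine ⟨A, fun σ hσ S => ?_⟩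
    have h : x ∈ σ • S.1 ↔ x ∈ S.1 := by
      rw [Set.mem_smul_set_iff_inv_smul_mem, hA _ hσ.inv]
    by_cases hx : x ∈ S.1
    · rw [Set.indicator_of_mem hx, Set.indicator_of_mem (by exact h.2 hx)]
    · rw [Set.indicator_of_notMem hx, Set.indicator_of_notMem (by exact fun h' => hx (h.1 h'))]
  additive S U _ hd hU := by
    simp only [hU]
    by_cases hx : x ∈ ⋃ i, (S i).1
    · obtain ⟨i, hi⟩ := Set.mem_iUnion.1 hx
      rw [tsum_eq_single i fun j hj =>
        Set.indicator_of_notMem (fun h => Set.disjoint_left.1 (hd hj) h hi) _,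
        Set.indicator_of_mem hx, Set.indicator_of_mem hi]
    · rw [Set.indicator_of_notMem hx, eq_comm, ENNReal.tsum_eq_zero]
      exact fun i => Set.indicator_of_notMem (fun h => hx (Set.mem_iUnion.2 ⟨i, h⟩)) _
  univ U hU := by simp [hU]

/-- The bind of the monad: `(μ >>= k)(S) = ∫ k(x, S) μ(dx)`. -/
def bind {X Y : NomSet G} (μ : Prob X) (k : X → Prob Y) (hk : FSK k) : Prob Y where
  toFun S := μ.int (fun x => (k x).toFun S)
  finSupp := by
    classical
    obtain ⟨A, hA⟩ := hk
    obtain ⟨B, hB⟩ := μ.finSupp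
    refine ⟨A ∪ B, fun σ hσ S => ?_⟩
    have hσμ : σ⁻¹ • μ = μ := Prob.ext' fun T => by
      rw [Prob.smul_toFun, inv_inv]; exact hB _ hσ.of_union_right T
    conv_rhs => rw [← hσμ]
    obtain ⟨C, hC⟩ := S.2
    rw [Prob.smul_int]
    · congr 1
      funext x
      rw [hA _ hσ.of_union_left.inv, Prob.smul_toFun, inv_inv]
    · exact ⟨A ∪ C, fun τ h x => FSK.toFun hA hC h.of_union_left h.of_union_right x⟩
  additive := by
    classical
    rintro S U ⟨C, hC⟩ hd hU
    obtain ⟨A, hA⟩ := hk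
    have hS : ∀ i, ∀ σ : GAut G, Fixes σ (A ∪ C) → ∀ x, (k (σ • x)).toFun (S i) = (k x).toFun (S i) :=
      fun i σ h x => FSK.toFun hA (hC i) h.of_union_left h.of_union_right x
    have hUC : Supports G C U.1 := by
      rw [hU]; exact @MeasurableSet.iUnion _ _ (suppAlg Y C) _ _ hC
    have hU' : ∀ σ : GAut G, Fixes σ (A ∪ C) → ∀ x, (k (σ • x)).toFun U = (k x).toFun U :=
      fun σ h x => FSK.toFun hA hUC h.of_union_left h.of_union_right x
    rw [μ.int_eq (φ := fun x => (k x).toFun U) hU',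
      tsum_congr fun i => μ.int_eq (φ := fun x => (k x).toFun (S i)) (hS i),
      ← lintegral_tsum fun i =>
        (measurable_of_supp (φ := fun x => (k x).toFun (S i)) (hS i)).aemeasurable]
    congr 1
    funext x
    exact (k x).additive S U ⟨C, hC⟩ hd hU
  univ U hU := by
    simp_rw [fun x => (k x).univ U hU, μ.int_const]

theorem int_dirac {X : NomSet G} (x : X) {φ : X → ℝ≥0∞} (hφ : FS φ) : (dirac x).int φ = φ x := by
  obtain ⟨A, hA⟩ := hφ
  have hm := measurable_of_supp hA
  rw [(dirac x).int_eq hA]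
  rw [show (dirac x).measure A = @Measure.dirac X (suppAlg X A) x from
    @Measure.ext X (suppAlg X A) _ _ fun S hS => by
      rw [Prob.measure_apply _ hS, @Measure.dirac_apply' X (suppAlg X A) _ _ hS]; rfl]
  exact @lintegral_dirac' X (suppAlg X A) _ _ hm

theorem int_bind {X Y : NomSet G} (μ : Prob X) (k : X → Prob Y) (hk : FSK k) {φ : Y → ℝ≥0∞}
    (hφ : FS φ) : (bind μ k hk).int φ = μ.int (fun x => (k x).int φ) := by
  classical
  obtain ⟨B, hB⟩ := hφ
  obtain ⟨A, hA⟩ := id hk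
  have hAB : ∀ σ : GAut G, Fixes σ (A ∪ B) → ∀ x, (k (σ • x)).int φ = (k x).int φ :=
    fun σ h x => FSK.apply hA hB h.of_union_left h.of_union_right x
  have hB' : ∀ σ : GAut G, Fixes σ (A ∪ B) → ∀ x, φ (σ • x) = φ x :=
    fun σ h x => hB σ h.of_union_right x
  rw [(bind μ k hk).int_eq hB', μ.int_eq hAB]
  simp_rw [fun x => (k x).int_eq hB']
  let mX := suppAlg X (A ∪ B)
  let mY := suppAlg Y (A ∪ B)
  have hmk : Measurable (fun x => (k x).measure (A ∪ B)) := by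
    refine Measure.measurable_of_measurable_coe _ fun S hS => ?_
    have : ∀ x, (k x).measure (A ∪ B) S = (k x).toFun ⟨S, A ∪ B, hS⟩ :=
      fun x => Prob.measure_apply _ hS
    simp_rw [this]
    exact measurable_of_supp fun σ h x => FSK.toFun hA (S := ⟨S, A ∪ B, hS⟩) (B := A ∪ B) hS h.of_union_left h x
  rw [← Measure.lintegral_bind hmk.aemeasurable (measurable_of_supp hB').aemeasurable]
  congr 1
  refine Measure.ext fun S hS => ?_
  rw [Prob.measure_apply _ hS, Measure.bind_apply hS hmk.aemeasurable]
  have : ∀ x, (k x).measure (A ∪ B) S = (k x).toFun ⟨S, A ∪ B, hS⟩ :=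
    fun x => Prob.measure_apply _ hS
  simp_rw [this]
  exact μ.int_eq fun σ h x => FSK.toFun hA (S := ⟨S, A ∪ B, hS⟩) (B := A ∪ B) hS h.of_union_left h x


theorem FSK.of_equivariant {X Y : NomSet G} {k : X → Prob Y}
    (h : ∀ (σ : GAut G) (x : X), k (σ • x) = σ • k x) : FSK k := ⟨∅, fun σ _ x => h σ x⟩

theorem FS.comp {X Y : NomSet G} {φ : Y → ℝ≥0∞} (hφ : FS φ) {u : X → Y} (hu : Equivariant u) :
    FS (fun x => φ (u x)) := by
  obtain ⟨A, hA⟩ := hφ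
  exact ⟨A, fun σ h x => (congrArg φ (hu σ x)).trans (hA σ h _)⟩

theorem FS.curry {X Y : NomSet G} {φ : prod X Y → ℝ≥0∞} (hφ : FS φ) (x : X) :
    FS (fun y : Y => φ (x, y)) := by
  classical
  obtain ⟨A, hA⟩ := hφ
  obtain ⟨B, hB⟩ := X.finSupp x
  refine ⟨A ∪ B, fun σ h y => ?_⟩
  refine Eq.trans (congrArg φ ?_) (hA σ h.of_union_left (x, y))
  exact Prod.ext (hB σ h.of_union_right).symm rfl

theorem FS.curry' {X Y : NomSet G} {φ : prod X Y → ℝ≥0∞} (hφ : FS φ) (y : Y) :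
    FS (fun x : X => φ (x, y)) := by
  classical
  obtain ⟨A, hA⟩ := hφ
  obtain ⟨B, hB⟩ := Y.finSupp y
  refine ⟨A ∪ B, fun σ h x => ?_⟩
  refine Eq.trans (congrArg φ ?_) (hA σ h.of_union_left (x, y))
  exact Prod.ext rfl (hB σ h.of_union_right).symm

theorem FS.int_snd {X Y : NomSet G} {φ : prod X Y → ℝ≥0∞} (hφ : FS φ) (μ : Prob Y) :
    FS (fun x : X => μ.int (fun y => φ (x, y))) := by
  classical
  obtain ⟨A, hA⟩ := id hφ
  obtain ⟨B, hB⟩ := μ.finSupp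
  refine ⟨A ∪ B, fun σ h x => ?_⟩
  have hμ : σ • μ = μ := Prob.ext' fun S => hB _ h.of_union_right.inv S
  change μ.int (fun y => φ (σ • x, y)) = _
  conv_lhs => rw [← hμ]
  rw [Prob.smul_int _ _ (hφ.curry _)]
  exact congrArg μ.int (funext fun y => hA σ h.of_union_left (x, y))

theorem FS.int_fst {X Y : NomSet G} {φ : prod X Y → ℝ≥0∞} (hφ : FS φ) (μ : Prob X) :
    FS (fun y : Y => μ.int (fun x => φ (x, y))) :=
  FS.int_snd (φ := fun p : prod Y X => φ (p.2, p.1)) (hφ.comp (u := fun p : prod Y X => ((p.2, p.1) : prod X Y))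
    fun _ _ => rfl) μ

theorem FS.smul {X : NomSet G} {φ : X → ℝ≥0∞} (hφ : FS φ) (σ : GAut G) :
    FS (fun x => φ (σ • x)) := by
  classical
  obtain ⟨A, hA⟩ := hφ
  refine ⟨A.image (fun a => σ⁻¹ a), fun τ hτ y => ?_⟩
  have := hA _ hτ.conj (σ • y)
  simpa [mul_smul] using this

theorem smul_dirac {X : NomSet G} (σ : GAut G) (x : X) : dirac (σ • x) = σ • dirac x :=
  Prob.ext_int fun φ hφ => by
    rw [Prob.smul_int _ _ hφ, int_dirac _ hφ, int_dirac _ (hφ.smul σ)]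

theorem fsk_dirac_right {X Y : NomSet G} (x : X) : FSK (fun y : Y => dirac (X := prod X Y) (x, y)) := by
  obtain ⟨A, hA⟩ := X.finSupp x
  refine ⟨A, fun σ h y => ?_⟩
  rw [← smul_dirac]
  exact congrArg dirac (Prod.ext (hA σ h).symm rfl)

theorem fsk_dirac_left {X Y : NomSet G} (y : Y) : FSK (fun x : X => dirac (X := prod X Y) (x, y)) := by
  obtain ⟨A, hA⟩ := Y.finSupp y
  refine ⟨A, fun σ h x => ?_⟩
  rw [← smul_dirac]
  exact congrArg dirac (Prod.ext rfl (hA σ h).symm)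

theorem fsk_right {X Y : NomSet G} (ν : Prob Y) :
    FSK (fun x : X => bind ν (fun y => dirac (X := prod X Y) (x, y)) (fsk_dirac_right x)) := by
  obtain ⟨A, hA⟩ := ν.finSupp
  refine ⟨A, fun σ h x => Prob.ext_int fun φ hφ => ?_⟩
  have hν : σ • ν = ν := Prob.ext' fun S => hA _ h.inv S
  rw [Prob.smul_int _ _ hφ, int_bind _ _ _ hφ, int_bind _ _ _ (hφ.smul σ)]
  simp_rw [int_dirac _ hφ, int_dirac _ (hφ.smul σ)]
  conv_lhs => rw [← hν]
  rw [Prob.smul_int _ _ (hφ.curry _)]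
  rfl

theorem fsk_left {X Y : NomSet G} (μ : Prob X) :
    FSK (fun y : Y => bind μ (fun x => dirac (X := prod X Y) (x, y)) (fsk_dirac_left y)) := by
  obtain ⟨A, hA⟩ := μ.finSupp
  refine ⟨A, fun σ h y => Prob.ext_int fun φ hφ => ?_⟩
  have hμ : σ • μ = μ := Prob.ext' fun S => hA _ h.inv S
  rw [Prob.smul_int _ _ hφ, int_bind _ _ _ hφ, int_bind _ _ _ (hφ.smul σ)]
  simp_rw [int_dirac _ hφ, int_dirac _ (hφ.smul σ)]
  conv_lhs => rw [← hμ]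
  rw [Prob.smul_int _ _ (hφ.curry' _)]
  rfl

/-- `μ ⊗ ν = μ >>= λ x. ν >>= λ y. η(x, y)`. -/
def pairL {X Y : NomSet G} (μ : Prob X) (ν : Prob Y) : Prob (prod X Y) :=
  bind μ (fun x => bind ν (fun y => dirac (X := prod X Y) (x, y)) (fsk_dirac_right x)) (fsk_right ν)

/-- The product in the other order: `ν >>= λ y. μ >>= λ x. η(x, y)`. -/
def pairR {X Y : NomSet G} (μ : Prob X) (ν : Prob Y) : Prob (prod X Y) :=
  bind ν (fun y => bind μ (fun x => dirac (X := prod X Y) (x, y)) (fsk_dirac_left y)) (fsk_left μ)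

theorem int_pairL {X Y : NomSet G} (μ : Prob X) (ν : Prob Y) {φ : prod X Y → ℝ≥0∞} (hφ : FS φ) :
    (pairL μ ν).int φ = μ.int (fun x => ν.int (fun y => φ (x, y))) := by
  rw [pairL, int_bind _ _ _ hφ]
  simp_rw [int_bind _ _ _ hφ, int_dirac _ hφ]

theorem int_pairR {X Y : NomSet G} (μ : Prob X) (ν : Prob Y) {φ : prod X Y → ℝ≥0∞} (hφ : FS φ) :
    (pairR μ ν).int φ = ν.int (fun y => μ.int (fun x => φ (x, y))) := by
  rw [pairR, int_bind _ _ _ hφ]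
  simp_rw [int_bind _ _ _ hφ, int_dirac _ hφ]

theorem smul_bind {X Y : NomSet G} (σ : GAut G) (μ : Prob X) (k : X → Prob Y) (hk : FSK k)
    (he : ∀ x, k (σ • x) = σ • k x) : bind (σ • μ) k hk = σ • bind μ k hk :=
  Prob.ext_int fun φ hφ => by
    rw [Prob.smul_int _ _ hφ, int_bind _ _ _ hφ, int_bind _ _ _ (hφ.smul σ),
      Prob.smul_int _ _ (hk.int hφ)]
    simp_rw [he, Prob.smul_int _ _ hφ]

theorem smul_pairL {X Y : NomSet G} (σ : GAut G) (μ : Prob X) (ν : Prob Y) :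
    pairL (σ • μ) (σ • ν) = σ • pairL μ ν :=
  Prob.ext_int fun φ hφ => by
    rw [Prob.smul_int _ _ hφ, int_pairL _ _ hφ, int_pairL _ _ (hφ.smul σ),
      Prob.smul_int _ _ (hφ.int_snd _)]
    simp_rw [Prob.smul_int _ _ (hφ.curry _)]
    rfl

/-! ### Strong submonads and their Kleisli categories -/

/-- A strong submonad of the monad of finitely supported probability measures: for each nominal set
`X` a nominal subset of `P X`, containing the Dirac measures and closed under (internal) bind. -/
structure StrongSubmonad (G : SimpleGraph V) where
  mem : ∀ X : NomSet G, Set (Prob X)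
  smul_mem : ∀ (X : NomSet G) (σ : GAut G) (μ : Prob X), μ ∈ mem X → σ • μ ∈ mem X
  dirac_mem : ∀ (X : NomSet G) (x : X), dirac x ∈ mem X
  bind_mem : ∀ (X Y : NomSet G) (μ : Prob X) (k : X → Prob Y) (hk : FSK k),
    μ ∈ mem X → (∀ x, k x ∈ mem Y) → bind μ k hk ∈ mem Y

/-- The least strong submonad containing the given measures. -/
def StrongSubmonad.generate (gens : ∀ X : NomSet G, Set (Prob X)) : StrongSubmonad G where
  mem X := {μ | ∀ T : StrongSubmonad G, (∀ Y, gens Y ⊆ T.mem Y) → μ ∈ T.mem X}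
  smul_mem X σ μ h T hT := T.smul_mem X σ μ (h T hT)
  dirac_mem X x T _ := T.dirac_mem X x
  bind_mem X Y μ k hk h h' T hT := T.bind_mem X Y μ k hk (h T hT) fun x => h' x T hT

/-- The nominal set `T X`. -/
def StrongSubmonad.obj (T : StrongSubmonad G) (X : NomSet G) : NomSet G where
  carrier := T.mem X
  action :=
    { smul := fun σ μ => ⟨σ • μ.1, T.smul_mem X σ _ μ.2⟩
      one_smul := fun μ => Subtype.ext (one_smul _ μ.1)
      mul_smul := fun σ τ μ => Subtype.ext (mul_smul σ τ μ.1) }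
  finSupp μ := by
    obtain ⟨A, hA⟩ := (probs X).finSupp μ.1
    exact ⟨A, fun σ h => Subtype.ext (hA σ h)⟩

/-- The objects of the Kleisli category of `T`: nominal sets. -/
structure Kl (T : StrongSubmonad G) where
  of ::
  obj : NomSet G

/-- The morphisms of the Kleisli category of `T`: equivariant functions `X → T Y`. -/
@[ext] structure KlHom (T : StrongSubmonad G) (X Y : NomSet G) where
  toFun : X → Prob Y
  equivariant : ∀ (σ : GAut G) (x : X), toFun (σ • x) = σ • toFun x
  mem : ∀ x, toFun x ∈ T.mem Y

variable {T : StrongSubmonad G}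

/-- The Kleisli morphism `η ∘ u` of an equivariant function `u`. -/
def KlHom.pure (T : StrongSubmonad G) {X Y : NomSet G} (u : X → Y) (hu : Equivariant u) :
    KlHom T X Y where
  toFun x := dirac (u x)
  equivariant σ x := by rw [hu, smul_dirac]
  mem x := T.dirac_mem _ _

theorem KlHom.fsk {X Y : NomSet G} (f : KlHom T X Y) : FSK f.toFun := .of_equivariant f.equivariant

theorem KlHom.fs {X Y : NomSet G} (f : KlHom T X Y) {φ : Y → ℝ≥0∞} (hφ : FS φ) :
    FS (fun x => (f.toFun x).int φ) := f.fsk.int hφ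

/-- Kleisli composition. -/
def KlHom.comp {X Y Z : NomSet G} (f : KlHom T X Y) (g : KlHom T Y Z) : KlHom T X Z where
  toFun x := bind (f.toFun x) g.toFun g.fsk
  equivariant σ x := by
    rw [f.equivariant]; exact smul_bind σ _ _ _ (g.equivariant σ)
  mem x := T.bind_mem _ _ _ _ _ (f.mem x) g.mem

/-- The monoidal product of Kleisli morphisms: `(x, y) ↦ f(x) ⊗ g(y)`. -/
def KlHom.tensor {X Y X' Y' : NomSet G} (f : KlHom T X Y) (g : KlHom T X' Y') :
    KlHom T (prod X X') (prod Y Y') where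
  toFun p := pairL (f.toFun p.1) (g.toFun p.2)
  equivariant σ p := by
    rw [← smul_pairL, ← f.equivariant, ← g.equivariant]; rfl
  mem p := T.bind_mem _ _ _ _ _ (f.mem _) fun x =>
    T.bind_mem _ _ _ _ _ (g.mem _) fun y => T.dirac_mem _ _

/-- Copairing. -/
def KlHom.copair {X Y Z : NomSet G} (f : KlHom T X Z) (g : KlHom T Y Z) : KlHom T (sum X Y) Z where
  toFun p := Sum.elim f.toFun g.toFun p
  equivariant σ p := by
    rcases p with x | y
    · exact f.equivariant σ x
    · exact g.equivariant σ y
  mem p := by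
    rcases p with x | y
    · exact f.mem x
    · exact g.mem y

theorem KlHom.ext_int {X Y : NomSet G} {f g : KlHom T X Y}
    (h : ∀ (x : X) (φ : Y → ℝ≥0∞), FS φ → (f.toFun x).int φ = (g.toFun x).int φ) : f = g :=
  KlHom.ext (funext fun x => Prob.ext_int (h x))

theorem KlHom.comp_int {X Y Z : NomSet G} (f : KlHom T X Y) (g : KlHom T Y Z) (x : X)
    {φ : Z → ℝ≥0∞} (hφ : FS φ) :
    ((f.comp g).toFun x).int φ = (f.toFun x).int (fun y => (g.toFun y).int φ) :=
  int_bind _ _ g.fsk hφ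

theorem KlHom.pure_int {X Y : NomSet G} (u : X → Y) (hu : Equivariant u) (x : X)
    {φ : Y → ℝ≥0∞} (hφ : FS φ) : ((KlHom.pure T u hu).toFun x).int φ = φ (u x) :=
  int_dirac _ hφ

theorem KlHom.tensor_int {X Y X' Y' : NomSet G} (f : KlHom T X Y) (g : KlHom T X' Y')
    (p : prod X X') {φ : prod Y Y' → ℝ≥0∞} (hφ : FS φ) :
    ((f.tensor g).toFun p).int φ =
      (f.toFun p.1).int (fun y => (g.toFun p.2).int (fun y' => φ (y, y'))) :=
  int_pairL _ _ hφ

theorem Equivariant.id {X : NomSet G} : Equivariant (fun x : X => x) := fun _ _ => rfl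

instance : Category (Kl T) where
  Hom X Y := KlHom T X.obj Y.obj
  id X := KlHom.pure T (fun x => x) .id
  comp f g := KlHom.comp f g
  id_comp f := KlHom.ext_int fun x φ hφ => by
    rw [KlHom.comp_int _ _ _ hφ, KlHom.pure_int _ _ _ (f.fs hφ)]
  comp_id f := KlHom.ext_int fun x φ hφ => by
    rw [KlHom.comp_int _ _ _ hφ]; simp_rw [KlHom.pure_int _ _ _ hφ]
  assoc f g h := KlHom.ext_int fun x φ hφ => by
    rw [KlHom.comp_int _ _ _ hφ, KlHom.comp_int _ _ _ (h.fs hφ), KlHom.comp_int _ _ _ hφ]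
    simp_rw [KlHom.comp_int _ _ _ hφ]

/-- Two Kleisli morphisms out of the same object commute. -/
def Commute {X₁ X₂ X₃ : NomSet G} (f : KlHom T X₁ X₂) (g : KlHom T X₁ X₃) : Prop :=
  ∀ x, pairL (f.toFun x) (g.toFun x) = pairR (f.toFun x) (g.toFun x)

/-- A strong (sub)monad is commutative if all its Kleisli morphisms commute. -/
class StrongSubmonad.IsCommutative (T : StrongSubmonad G) : Prop where
  comm : ∀ {X₁ X₂ X₃ : NomSet G} (f : KlHom T X₁ X₂) (g : KlHom T X₁ X₃), Commute f g

theorem StrongSubmonad.swap [T.IsCommutative] {X Y : NomSet G} {μ : Prob X} {ν : Prob Y}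
    (hμ : μ ∈ T.mem X) (hν : ν ∈ T.mem Y) {φ : prod X Y → ℝ≥0∞} (hφ : FS φ) :
    μ.int (fun x => ν.int (fun y => φ (x, y))) = ν.int (fun y => μ.int (fun x => φ (x, y))) := by
  let f : KlHom T (prod (T.obj X) (T.obj Y)) X := ⟨fun p => p.1.1, fun _ _ => rfl, fun p => p.1.2⟩
  let g : KlHom T (prod (T.obj X) (T.obj Y)) Y := ⟨fun p => p.2.1, fun _ _ => rfl, fun p => p.2.2⟩
  have h := IsCommutative.comm f g (⟨μ, hμ⟩, ⟨ν, hν⟩)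
  rw [← int_pairL _ _ hφ, ← int_pairR _ _ hφ]
  exact congrArg (fun m => m.int φ) h

theorem KlHom.pure_comp {X Y Z : NomSet G} (u : X → Y) (hu : Equivariant u) (v : Y → Z)
    (hv : Equivariant v) : (KlHom.pure T u hu).comp (KlHom.pure T v hv) =
      KlHom.pure T (fun x => v (u x)) (fun σ x => (congrArg v (hu σ x)).trans (hv σ _)) :=
  KlHom.ext_int fun x φ hφ => by
    rw [comp_int _ _ _ hφ, pure_int _ _ _ ((KlHom.pure T v hv).fs hφ), pure_int _ _ _ hφ,
      pure_int _ _ _ hφ]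

theorem KlHom.pure_tensor {X Y X' Y' : NomSet G} (u : X → Y) (hu : Equivariant u) (v : X' → Y')
    (hv : Equivariant v) : (KlHom.pure T u hu).tensor (KlHom.pure T v hv) =
      KlHom.pure T (X := prod X X') (Y := prod Y Y') (fun p => (u p.1, v p.2))
        (fun σ p => Prod.ext (hu σ p.1) (hv σ p.2)) :=
  KlHom.ext_int fun x φ hφ => by
    rw [tensor_int _ _ _ hφ, pure_int _ _ _ (hφ.int_snd _), pure_int _ _ _ (hφ.curry _),
      pure_int _ _ _ hφ]

/-- The isomorphism of the Kleisli category given by mutually inverse equivariant functions. -/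
def Kl.iso {X Y : Kl T} (u : X.obj → Y.obj) (v : Y.obj → X.obj) (hu : Equivariant u)
    (hv : Equivariant v) (huv : ∀ x, v (u x) = x) (hvu : ∀ y, u (v y) = y) : X ≅ Y where
  hom := KlHom.pure T u hu
  inv := KlHom.pure T v hv
  hom_inv_id := (KlHom.pure_comp _ _ _ _).trans (KlHom.ext (funext fun x => congrArg dirac (huv x)))
  inv_hom_id := (KlHom.pure_comp _ _ _ _).trans (KlHom.ext (funext fun x => congrArg dirac (hvu x)))

/-- The one-point nominal set. -/
abbrev one (G : SimpleGraph V) : NomSet G := disc G Unit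

instance : MonoidalCategoryStruct (Kl T) where
  tensorObj X Y := ⟨prod X.obj Y.obj⟩
  tensorUnit := ⟨one G⟩
  tensorHom f g := KlHom.tensor f g
  whiskerLeft X _ _ f := KlHom.tensor (KlHom.pure T (X := X.obj) (fun x => x) .id) f
  whiskerRight f Y := KlHom.tensor f (KlHom.pure T (X := Y.obj) (fun x => x) .id)
  associator X Y Z := Kl.iso (X := ⟨prod (prod X.obj Y.obj) Z.obj⟩)
    (Y := ⟨prod X.obj (prod Y.obj Z.obj)⟩) (fun p => (p.1.1, (p.1.2, p.2)))
    (fun p => ((p.1, p.2.1), p.2.2)) (fun _ _ => rfl) (fun _ _ => rfl) (fun _ => rfl) (fun _ => rfl)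
  leftUnitor X := Kl.iso (X := ⟨prod (one G) X.obj⟩) (Y := X) (fun p => p.2) (fun x => ((), x))
    (fun _ _ => rfl) (fun _ _ => rfl) (fun _ => rfl) (fun _ => rfl)
  rightUnitor X := Kl.iso (X := ⟨prod X.obj (one G)⟩) (Y := X) (fun p => p.1) (fun x => (x, ()))
    (fun _ _ => rfl) (fun _ _ => rfl) (fun _ => rfl) (fun _ => rfl)

theorem KlHom.tensor_comp_tensor [T.IsCommutative] {X₁ Y₁ Z₁ X₂ Y₂ Z₂ : NomSet G}
    (f₁ : KlHom T X₁ Y₁) (f₂ : KlHom T X₂ Y₂) (g₁ : KlHom T Y₁ Z₁) (g₂ : KlHom T Y₂ Z₂) :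
    (f₁.tensor f₂).comp (g₁.tensor g₂) = (f₁.comp g₁).tensor (f₂.comp g₂) :=
  KlHom.ext_int fun p φ hφ => by
    rw [comp_int _ _ _ hφ, tensor_int _ _ _ ((g₁.tensor g₂).fs hφ), tensor_int _ _ _ hφ,
      comp_int _ _ _ (hφ.int_snd _)]
    simp_rw [tensor_int _ _ _ hφ, comp_int _ _ _ (hφ.curry _)]
    congr 1
    funext a
    let ψ : prod Z₁ Y₂ → ℝ≥0∞ := fun q => (g₂.toFun q.2).int (fun d => φ (q.1, d))
    have hψ : FS ψ := by
      have := ((KlHom.pure T (X := Z₁) (fun x => x) .id).tensor g₂).fs hφ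
      convert this using 2 with q
      rw [tensor_int _ _ _ hφ, pure_int _ _ _ (hφ.int_snd _)]
    exact (StrongSubmonad.swap (T := T) (g₁.mem a) (f₂.mem p.2) hψ).symm

theorem KlHom.assoc_nat {X₁ X₂ X₃ Y₁ Y₂ Y₃ : NomSet G}
    (f₁ : KlHom T X₁ Y₁) (f₂ : KlHom T X₂ Y₂) (f₃ : KlHom T X₃ Y₃) :
    ((f₁.tensor f₂).tensor f₃).comp (KlHom.pure T (X := prod (prod Y₁ Y₂) Y₃)
      (Y := prod Y₁ (prod Y₂ Y₃)) (fun p => (p.1.1, (p.1.2, p.2))) (fun _ _ => rfl)) =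
    (KlHom.pure T (X := prod (prod X₁ X₂) X₃)
      (Y := prod X₁ (prod X₂ X₃)) (fun p => (p.1.1, (p.1.2, p.2))) (fun _ _ => rfl)).comp
      (f₁.tensor (f₂.tensor f₃)) :=
  KlHom.ext_int fun p φ hφ => by
    rw [comp_int _ _ _ hφ, comp_int _ _ _ hφ, pure_int _ _ _ ((f₁.tensor (f₂.tensor f₃)).fs hφ)]
    have hφ' : FS (X := prod (prod Y₁ Y₂) Y₃) (fun p => φ (p.1.1, (p.1.2, p.2))) :=
      hφ.comp (X := prod (prod Y₁ Y₂) Y₃) (u := fun p => (p.1.1, (p.1.2, p.2))) (fun _ _ => rfl)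
    simp_rw [pure_int _ _ _ hφ]
    rw [tensor_int _ _ _ hφ', tensor_int _ _ _ (hφ'.int_snd _), tensor_int _ _ _ hφ]
    simp_rw [tensor_int _ _ _ (hφ.curry _)]

theorem KlHom.left_nat {X Y : NomSet G} (f : KlHom T X Y) :
    ((KlHom.pure T (X := one G) (fun x => x) .id).tensor f).comp
      (KlHom.pure T (X := prod (one G) Y) (Y := Y) (fun p => p.2) (fun _ _ => rfl)) =
    (KlHom.pure T (X := prod (one G) X) (Y := X) (fun p => p.2) (fun _ _ => rfl)).comp f :=
  KlHom.ext_int fun p φ hφ => by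
    rw [comp_int _ _ _ hφ, comp_int _ _ _ hφ, pure_int _ _ _ (f.fs hφ)]
    have h2 : FS (X := prod (one G) Y) (fun y => φ y.2) :=
      hφ.comp (X := prod (one G) Y) (u := fun p => p.2) (fun _ _ => rfl)
    simp_rw [pure_int _ _ _ hφ]
    rw [tensor_int _ _ _ h2, pure_int _ _ _ (h2.int_snd _)]

theorem KlHom.right_nat {X Y : NomSet G} (f : KlHom T X Y) :
    (f.tensor (KlHom.pure T (X := one G) (fun x => x) .id)).comp
      (KlHom.pure T (X := prod Y (one G)) (Y := Y) (fun p => p.1) (fun _ _ => rfl)) =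
    (KlHom.pure T (X := prod X (one G)) (Y := X) (fun p => p.1) (fun _ _ => rfl)).comp f :=
  KlHom.ext_int fun p φ hφ => by
    rw [comp_int _ _ _ hφ, comp_int _ _ _ hφ, pure_int _ _ _ (f.fs hφ)]
    have h2 : FS (X := prod Y (one G)) (fun y => φ y.1) :=
      hφ.comp (X := prod Y (one G)) (u := fun p => p.1) (fun _ _ => rfl)
    simp_rw [pure_int _ _ _ hφ]
    rw [tensor_int _ _ _ h2]
    simp_rw [pure_int _ _ _ (h2.curry _)]

theorem KlHom.swap_nat [T.IsCommutative] {X Y X' Y' : NomSet G} (f : KlHom T X Y)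
    (g : KlHom T X' Y') :
    (f.tensor g).comp (KlHom.pure T (X := prod Y Y') (Y := prod Y' Y) (fun p => (p.2, p.1))
      (fun _ _ => rfl)) =
    (KlHom.pure T (X := prod X X') (Y := prod X' X) (fun p => (p.2, p.1)) (fun _ _ => rfl)).comp
      (g.tensor f) :=
  KlHom.ext_int fun p φ hφ => by
    rw [comp_int _ _ _ hφ, comp_int _ _ _ hφ, pure_int _ _ _ ((g.tensor f).fs hφ)]
    have h2 : FS (X := prod Y Y') (fun p => φ (p.2, p.1)) :=
      hφ.comp (X := prod Y Y') (Y := prod Y' Y) (u := fun p => (p.2, p.1)) (fun _ _ => rfl)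
    simp_rw [pure_int _ _ _ hφ]
    rw [tensor_int _ _ _ h2, tensor_int _ _ _ hφ, StrongSubmonad.swap (f.mem _) (g.mem _) h2]

theorem Kl.comp_def {X Y Z : Kl T} (f : X ⟶ Y) (g : Y ⟶ Z) : f ≫ g = KlHom.comp f g := rfl

instance [T.IsCommutative] : MonoidalCategory (Kl T) :=
  MonoidalCategory.ofTensorHom
    (id_tensorHom_id := fun X Y => KlHom.pure_tensor _ _ _ _)
    (id_tensorHom := fun _ _ _ _ => rfl)
    (tensorHom_id := fun _ _ => rfl)
    (tensorHom_comp_tensorHom := fun f₁ f₂ g₁ g₂ => KlHom.tensor_comp_tensor f₁ f₂ g₁ g₂)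
    (associator_naturality := fun f₁ f₂ f₃ => KlHom.assoc_nat f₁ f₂ f₃)
    (leftUnitor_naturality := fun f => KlHom.left_nat f)
    (rightUnitor_naturality := fun f => KlHom.right_nat f)
    (pentagon := fun W X Y Z => by
      simp only [Kl.comp_def, MonoidalCategoryStruct.tensorHom, MonoidalCategoryStruct.associator,
        Kl.iso, CategoryStruct.id, MonoidalCategoryStruct.tensorObj, KlHom.pure_tensor,
        KlHom.pure_comp])
    (triangle := fun X Y => by
      simp only [Kl.comp_def, MonoidalCategoryStruct.tensorHom, MonoidalCategoryStruct.associator,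
        Kl.iso, CategoryStruct.id, MonoidalCategoryStruct.tensorObj, KlHom.pure_tensor,
        MonoidalCategoryStruct.tensorUnit, MonoidalCategoryStruct.leftUnitor,
        MonoidalCategoryStruct.rightUnitor, KlHom.pure_comp])


instance [T.IsCommutative] : SymmetricCategory (Kl T) where
  braiding X Y := Kl.iso (X := ⟨prod X.obj Y.obj⟩) (Y := ⟨prod Y.obj X.obj⟩)
    (fun p => (p.2, p.1)) (fun p => (p.2, p.1)) (fun _ _ => rfl) (fun _ _ => rfl) (fun _ => rfl)
    (fun _ => rfl)
  braiding_naturality_right X _ _ f := KlHom.swap_nat _ f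
  braiding_naturality_left f Z := KlHom.swap_nat f _
  hexagon_forward X Y Z := by
    simp only [Kl.comp_def, MonoidalCategoryStruct.whiskerLeft, MonoidalCategoryStruct.associator,
      MonoidalCategoryStruct.whiskerRight,
      Kl.iso, MonoidalCategoryStruct.tensorObj, KlHom.pure_tensor, KlHom.pure_comp]
  hexagon_reverse X Y Z := by
    simp only [Kl.comp_def, MonoidalCategoryStruct.whiskerLeft, MonoidalCategoryStruct.associator,
      MonoidalCategoryStruct.whiskerRight,
      Kl.iso, MonoidalCategoryStruct.tensorObj, KlHom.pure_tensor, KlHom.pure_comp]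
  symmetry X Y := by
    simp only [Kl.comp_def, Kl.iso, MonoidalCategoryStruct.tensorObj, KlHom.pure_comp]; rfl

/-- Copying and discarding are the Kleisli morphisms of the diagonal and of the map to a point. -/
instance [T.IsCommutative] (X : Kl T) : ComonObj X where
  counit := KlHom.pure T (Y := one G) (fun _ => ()) (fun _ _ => rfl)
  comul := KlHom.pure T (Y := prod X.obj X.obj) (fun x => (x, x)) (fun _ _ => rfl)
  counit_comul := by
    simp only [Kl.comp_def, MonoidalCategoryStruct.whiskerRight, MonoidalCategoryStruct.leftUnitor,
      Kl.iso, MonoidalCategoryStruct.tensorUnit,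
      MonoidalCategoryStruct.tensorObj, KlHom.pure_tensor, KlHom.pure_comp]
  comul_counit := by
    simp only [Kl.comp_def, MonoidalCategoryStruct.whiskerLeft, MonoidalCategoryStruct.rightUnitor,
      Kl.iso, MonoidalCategoryStruct.tensorUnit,
      MonoidalCategoryStruct.tensorObj, KlHom.pure_tensor, KlHom.pure_comp]
  comul_assoc := by
    simp only [Kl.comp_def, MonoidalCategoryStruct.whiskerLeft, MonoidalCategoryStruct.associator,
      MonoidalCategoryStruct.whiskerRight,
      Kl.iso, MonoidalCategoryStruct.tensorObj, KlHom.pure_tensor, KlHom.pure_comp]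

theorem KlHom.pure_deterministic [T.IsCommutative] {X Y : Kl T} (u : X.obj → Y.obj)
    (hu : Equivariant u) : IsComonHom (show X ⟶ Y from KlHom.pure T u hu) where
  hom_counit := by
    simp only [Kl.comp_def, ComonObj.counit, KlHom.pure_comp]
  hom_comul := by
    simp only [Kl.comp_def, ComonObj.comul, MonoidalCategoryStruct.tensorHom,
      MonoidalCategoryStruct.tensorObj, KlHom.pure_tensor, KlHom.pure_comp]

instance [T.IsCommutative] : MarkovCategory (Kl T) where
  isCommComonObj X :=
    { comul_comm := by
        simp only [Kl.comp_def, BraidedCategory.braiding, ComonObj.comul, Kl.iso,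
          MonoidalCategoryStruct.tensorObj, KlHom.pure_comp] }
  copy_tensor X Y := by
    simp only [Kl.comp_def, tensorμ, BraidedCategory.braiding, ComonObj.comul, Kl.iso,
      MonoidalCategoryStruct.whiskerLeft, MonoidalCategoryStruct.associator,
      MonoidalCategoryStruct.whiskerRight, MonoidalCategoryStruct.tensorHom,
      MonoidalCategoryStruct.tensorObj, KlHom.pure_tensor, KlHom.pure_comp]
  discard_tensor X Y := by
    simp only [Kl.comp_def, ComonObj.counit, Kl.iso, MonoidalCategoryStruct.leftUnitor,
      MonoidalCategoryStruct.tensorHom, MonoidalCategoryStruct.tensorUnit,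
      MonoidalCategoryStruct.tensorObj, KlHom.pure_tensor, KlHom.pure_comp]
  copy_unit := rfl
  discard_unit := rfl
  discard_natural {X Y} f := KlHom.ext_int fun x φ hφ => by
    refine (KlHom.comp_int (Z := one G) f _ x hφ).trans ?_
    have h1 : ∀ y : Y.obj, (KlHom.toFun (T := T) (Y := one G) ε[Y] y).int φ = φ () :=
      fun y => KlHom.pure_int (Y := one G) _ _ y hφ
    have h2 : (KlHom.toFun (T := T) (Y := one G) ε[X] x).int φ = φ () :=
      KlHom.pure_int (Y := one G) _ _ x hφ
    exact (congrArg _ (funext h1)).trans ((Prob.int_const _ _).trans h2.symm)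

theorem KlHom.pure_comp_left {X Y Z : NomSet G} (u : X → Y) (hu : Equivariant u)
    (f : KlHom T Y Z) : ((KlHom.pure T u hu).comp f).toFun = fun x => f.toFun (u x) :=
  funext fun x => Prob.ext_int fun φ hφ => by
    rw [comp_int _ _ _ hφ, pure_int _ _ _ (f.fs hφ)]

theorem isIso_of_eq {C : Type*} [Category C] {X Y : C} {f : X ⟶ Y} (g : X ⟶ Y) [IsIso g]
    (h : f = g) : IsIso f := h ▸ inferInstance

theorem Kl.distrib (X Y Z : NomSet G) :
    IsIso (show (⟨sum (prod X Z) (prod Y Z)⟩ : Kl T) ⟶ ⟨prod (sum X Y) Z⟩ from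
      KlHom.copair
        ((KlHom.pure T (Y := sum X Y) Sum.inl (fun _ _ => rfl)).tensor
          (KlHom.pure T (X := Z) (fun x => x) .id))
        ((KlHom.pure T (Y := sum X Y) Sum.inr (fun _ _ => rfl)).tensor
          (KlHom.pure T (X := Z) (fun x => x) .id))) := by
  let i : (⟨sum (prod X Z) (prod Y Z)⟩ : Kl T) ≅ ⟨prod (sum X Y) Z⟩ :=
    Kl.iso (Sum.elim (fun p => (Sum.inl p.1, p.2)) (fun p => (Sum.inr p.1, p.2)))
      (fun p => Sum.elim (fun x => Sum.inl (x, p.2)) (fun y => Sum.inr (y, p.2)) p.1)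
      (by rintro σ (p | p) <;> rfl) (by rintro σ ⟨(p | p), z⟩ <;> rfl)
      (by rintro (p | p) <;> rfl) (by rintro ⟨(p | p), z⟩ <;> rfl)
  refine isIso_of_eq i.hom (KlHom.ext (funext fun p => ?_))
  rcases p with p | p
  · exact congrArg (fun f => KlHom.toFun f p) (KlHom.pure_tensor (T := T) (Y := sum X Y) Sum.inl
      (fun _ _ => rfl) (fun z : Z => z) .id)
  · exact congrArg (fun f => KlHom.toFun f p) (KlHom.pure_tensor (T := T) (Y := sum X Y) Sum.inr
      (fun _ _ => rfl) (fun z : Z => z) .id)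

instance [T.IsCommutative] : DistributiveMarkovCategory (Kl T) where
  zero := ⟨disc G Empty⟩
  fromZero X := ⟨Empty.elim, fun _ x => x.elim, fun x => x.elim⟩
  fromZero_uniq f := KlHom.ext (funext fun x => x.elim)
  coprod X Y := ⟨sum X.obj Y.obj⟩
  inl X Y := KlHom.pure T (Y := sum X.obj Y.obj) Sum.inl (fun _ _ => rfl)
  inr X Y := KlHom.pure T (Y := sum X.obj Y.obj) Sum.inr (fun _ _ => rfl)
  copair f g := KlHom.copair f g
  inl_copair f g := KlHom.ext (KlHom.pure_comp_left _ _ _)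
  inr_copair f g := KlHom.ext (KlHom.pure_comp_left _ _ _)
  copair_uniq {X Y Z} h := KlHom.ext (funext fun p => by
    rcases p with x | y
    · exact (congrFun (KlHom.pure_comp_left (Y := sum X.obj Y.obj) Sum.inl (fun _ _ => rfl) h) x).symm
    · exact (congrFun (KlHom.pure_comp_left (Y := sum X.obj Y.obj) Sum.inr (fun _ _ => rfl) h) y).symm)
  distrib_isIso X Y Z := Kl.distrib X.obj Y.obj Z.obj
  distrib_zero_isIso Z := by
    let i : (⟨disc G Empty⟩ : Kl T) ≅ ⟨prod (disc G Empty) Z.obj⟩ :=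
      Kl.iso (fun x => x.elim) (fun p => p.1) (fun _ x => x.elim) (fun _ _ => rfl)
        (fun x => x.elim) (fun p => p.1.elim)
    refine isIso_of_eq i.hom (KlHom.ext (funext fun x => x.elim))
  inl_deterministic X Y := KlHom.pure_deterministic (Y := ⟨sum X.obj Y.obj⟩) _ _
  inr_deterministic X Y := KlHom.pure_deterministic (Y := ⟨sum X.obj Y.obj⟩) _ _

/-! ### The Erdős–Rényi measure on the vertices and the submonad it generates -/

/-- `ν` is the internal probability measure `ν_α` on the vertices: it is equivariant and, for every
event `S`, every finite support `A` of `S` and every choice of vertices `v B ∉ A`, one for each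
possible set `B ⊆ A` of neighbours in `A`,
`ν S = ∑_B [v B ∈ S] ∏_{a ∈ A} (α [E(v B, a)] + (1 - α) [¬ E(v B, a)])`. -/
structure IsErdosRenyi (G : SimpleGraph V) (α : unitInterval) (ν : Prob (vertices G)) : Prop where
  equivariant : ∀ σ : GAut G, σ • ν = ν
  formula : ∀ (S : Event (vertices G)) (A : Finset V), Supports G A S.1 →
    ∀ v : Finset V → V, (∀ B ⊆ A, v B ∉ A ∧ ∀ a ∈ A, G.Adj (v B) a ↔ a ∈ B) →
    open Classical in
    ν.toFun S = ENNReal.ofReal (∑ B ∈ A.powerset, (if v B ∈ S.1 then 1 else 0) *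
      ∏ a ∈ A, if G.Adj (v B) a then (α : ℝ) else 1 - α)

/-- The nominal set `2 = 1 + 1`, with `0 = inl ()` and `1 = inr ()`. -/
abbrev two (G : SimpleGraph V) : NomSet G := sum (one G) (one G)

/-- `bernoulli(r) = r · η(0) + (1 - r) · η(1)`. -/
def bernoulli (G : SimpleGraph V) (r : unitInterval) : Prob (two G) where
  toFun S := ENNReal.ofReal r * (dirac (X := two G) (Sum.inl ())).toFun S +
    ENNReal.ofReal (1 - r) * (dirac (X := two G) (Sum.inr ())).toFun S
  finSupp := by
    refine ⟨∅, fun σ _ S => ?_⟩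
    have : σ • S = S := Subtype.ext (by
      ext x
      rw [Event.smul_val, Set.mem_smul_set_iff_inv_smul_mem]
      rcases x with x | x <;> rfl)
    rw [this]
  additive S U hA hd hU := by
    rw [(dirac _).additive S U hA hd hU, (dirac _).additive S U hA hd hU, ENNReal.tsum_add,
      ENNReal.tsum_mul_left, ENNReal.tsum_mul_left]
  univ U hU := by
    rw [(dirac _).univ U hU, (dirac _).univ U hU, mul_one, mul_one,
      ← ENNReal.ofReal_add r.2.1 (by linarith [r.2.2])]
    simp

/-- The generators `ν : 1 → P(V)` and `bernoulli : [0,1] → P(2)`. -/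
inductive Generator (ν : Prob (vertices G)) : ∀ X : NomSet G, Prob X → Prop
  | nu : Generator ν (vertices G) ν
  | bern (r : unitInterval) : Generator ν (two G) (bernoulli G r)

/-- The least strong submonad `P_α` of `P` containing `ν = ν_α` and the Bernoulli measures. -/
def erMonad (ν : Prob (vertices G)) : StrongSubmonad G :=
  StrongSubmonad.generate fun X => {μ | Generator ν X μ}

theorem nu_mem (ν : Prob (vertices G)) : ν ∈ (erMonad ν).mem (vertices G) :=
  fun _ hT => hT _ Generator.nu

/-- The interpretation of the graph interface in the Kleisli category of `P_α`: `vertex` is the set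
of vertices of the Rado graph, `new` is `ν_α`, and `edge` is the Dirac measure on the edge relation. -/
def radoModel {α : unitInterval} {ν : Prob (vertices G)} (hν : IsErdosRenyi G α ν)
    [(erMonad ν).IsCommutative] : GraphModel (Kl (erMonad ν)) where
  vertex := ⟨vertices G⟩
  new := ⟨fun _ => ν, fun σ _ => (hν.equivariant σ).symm, fun _ => nu_mem ν⟩
  edge := KlHom.pure _ (X := prod (vertices G) (vertices G)) (Y := two G)
    (open Classical in fun p => if G.Adj p.1 p.2 then Sum.inr () else Sum.inl ())
    (fun σ p => by
      classical
      have h : G.Adj (σ p.1) (σ p.2) ↔ G.Adj p.1 p.2 := σ.map_rel_iff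
      change (if G.Adj (σ p.1) (σ p.2) then (Sum.inr () : Unit ⊕ Unit) else Sum.inl ()) =
        σ • (if G.Adj p.1 p.2 then (Sum.inr () : two G) else Sum.inl ())
      simp only [h]
      split_ifs <;> rfl)

/-- The standard reading of numeral morphisms: the `(i, j)` entry of `Ψ f` is the probability that
the measure `f(i)` assigns to the outcome `j`. -/
def IsStandard [T.IsCommutative] (Ψ : BernoulliBase (Kl T)) : Prop :=
  ∀ {m n : ℕ} (f : num (Kl T) m ⟶ num (Kl T) n) (i : Fin m) (j : Fin n)
    (S : Event (num (Kl T) n).obj),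
    S.1 = {y | dirac y = KlHom.toFun (pt (Kl T) n j) ()} →
    Ψ.map f i j = ((KlHom.toFun (pt (Kl T) m i ≫ f) ()).toFun S).toReal

end

end RadoNominal

namespace RadoNominal

noncomputable section

open scoped Classical

variable {V : Type} {G : SimpleGraph V}

/-! ### Homogeneity of the Rado graph -/

/-! Everything rests on homogeneity of the Rado graph, `PartialAut.exists_aut`: for a finite set
`A`, the orbits outside `A` of the automorphisms fixing `A` are the types over `A`, one for each set
`B ⊆ A` of neighbours. A function supported by `A` therefore takes one value per type, and ν_α is
the finite weighted sum over types with a factor α for each neighbour in `A` and 1 - α for each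
non-neighbour, the vertices of `A` being null. The result does not depend on `A`: enlarging `A` by a
vertex divides each type in two, with relative weights α and 1 - α (`expect_eq_insert`).

Commutativity needs checking on generators only. The measures commuting with an invariant family
form a strong submonad, and applying this twice shows that pairwise commuting generators generate a
commutative submonad (`StrongSubmonad.generate_isCommutative`). A Bernoulli measure commutes with
everything by linearity. For ν_α with itself, a pair of vertices drawn in succession is described,
up to automorphisms fixing `A`, by the two types over `A` and the adjacency of the pair
(`SameType.apply_eq₂`); the weight of this description is symmetric in the two vertices
(`commuting_erdosRenyi`).

Numerals carry the trivial action, so an internal measure on one is an ordinary probability vector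
(`int_num`), Kleisli composition between numerals is matrix multiplication (`mass_comp`), and the
vectors determine the morphism. This gives the faithful functor Ψ.

Finally, `t_n` draws `n` vertices and then computes deterministically. Drawn vertices may be taken
distinct, and prescribing the adjacencies of a new vertex to `n` distinct old ones singles out one
type, whose weight is a product of factors α and 1 - α (`int_matrixInd_snoc`). Induction on `n`
gives the product over all pairs, which is the integral for the constant graphon. -/

/-- A finite partial automorphism of a graph, as a finite set of pairs. -/
def PartialAut (G : SimpleGraph V) : Type :=
  {f : Finset (V × V) // ∀ p ∈ f, ∀ q ∈ f,
    (p.1 = q.1 ↔ p.2 = q.2) ∧ (G.Adj p.1 q.1 ↔ G.Adj p.2 q.2)}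

namespace PartialAut

instance : Preorder (PartialAut G) := Subtype.preorder _

/-- The one-point extension of the back-and-forth. If `v` is in the domain its image serves.
Otherwise the extension property supplies a vertex joined to the images of the neighbours of `v` and
to none of the images of the non-neighbours; these two sets are disjoint because `f` is injective,
and together they exhaust the range, so the vertex is new. -/
theorem exists_across (hG : IsRado G) (f : PartialAut G) (v : V) :
    ∃ w, ∀ p ∈ f.1, (p.1 = v ↔ p.2 = w) ∧ (G.Adj p.1 v ↔ G.Adj p.2 w) := by
  by_cases h : ∃ w, (v, w) ∈ f.1
  · obtain ⟨w, hw⟩ := h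
    exact ⟨w, fun p hp => f.2 p hp _ hw⟩
  obtain ⟨w, hA, hB, hadj, hnadj⟩ := hG.extension ((f.1.filter fun p => G.Adj p.1 v).image Prod.snd)
    ((f.1.filter fun p => ¬ G.Adj p.1 v).image Prod.snd) (by
      rw [Finset.disjoint_left]
      intro x hx hy
      simp only [Finset.mem_image, Finset.mem_filter] at hx hy
      obtain ⟨p, ⟨hp, hpv⟩, rfl⟩ := hx
      obtain ⟨q, ⟨hq, hqv⟩, hqp⟩ := hy
      exact hqv (((f.2 q hq p hp).1.2 hqp) ▸ hpv))
  have hmem : ∀ p ∈ f.1, p.2 ≠ w := by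
    rintro p hp rfl
    by_cases hpv : G.Adj p.1 v
    · exact hA (Finset.mem_image_of_mem _ (Finset.mem_filter.2 ⟨hp, hpv⟩))
    · exact hB (Finset.mem_image_of_mem _ (Finset.mem_filter.2 ⟨hp, hpv⟩))
  refine ⟨w, fun p hp => ⟨iff_of_false ?_ (hmem p hp), ?_⟩⟩
  · rintro rfl
    exact h ⟨p.2, hp⟩
  · by_cases hpv : G.Adj p.1 v
    · exact iff_of_true hpv
        (hadj _ (Finset.mem_image_of_mem _ (Finset.mem_filter.2 ⟨hp, hpv⟩))).symm
    · exact iff_of_false hpv fun h' =>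
        hnadj _ (Finset.mem_image_of_mem _ (Finset.mem_filter.2 ⟨hp, hpv⟩)) h'.symm

/-- The extension of a partial automorphism by a pair. -/
def extend (f : PartialAut G) (v w : V)
    (h : ∀ p ∈ f.1, (p.1 = v ↔ p.2 = w) ∧ (G.Adj p.1 v ↔ G.Adj p.2 w)) : PartialAut G :=
  ⟨insert (v, w) f.1, fun p hp q hq => by
    rw [Finset.mem_insert] at hp hq
    rcases hp with rfl | hp <;> rcases hq with rfl | hq
    · simp
    · rw [eq_comm, G.adj_comm, eq_comm (a := w), G.adj_comm w]
      exact h q hq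
    · exact h p hp
    · exact f.2 p hp q hq⟩

theorem le_extend (f : PartialAut G) (v w : V)
    (h : ∀ p ∈ f.1, (p.1 = v ↔ p.2 = w) ∧ (G.Adj p.1 v ↔ G.Adj p.2 w)) :
    f ≤ f.extend v w h := Finset.subset_insert (v, w) f.1

/-- The inverse of a partial automorphism. -/
def symm (f : PartialAut G) : PartialAut G :=
  ⟨f.1.image Prod.swap, fun p hp q hq => by
    obtain ⟨r, hr, rfl⟩ := Finset.mem_image.1 hp
    obtain ⟨s, hs, rfl⟩ := Finset.mem_image.1 hq
    exact ⟨(f.2 r hr s hs).1.symm, (f.2 r hr s hs).2.symm⟩⟩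

/-- The partial automorphisms defined at `v`. -/
def definedAtLeft (hG : IsRado G) (v : V) : Order.Cofinal (PartialAut G) where
  carrier := {f | ∃ w, (v, w) ∈ f.1}
  isCofinal f := by
    obtain ⟨w, hw⟩ := f.exists_across hG v
    exact ⟨f.extend v w hw, ⟨w, Finset.mem_insert_self _ _⟩, f.le_extend v w hw⟩

/-- The partial automorphisms with `w` in their range. -/
def definedAtRight (hG : IsRado G) (w : V) : Order.Cofinal (PartialAut G) where
  carrier := {f | ∃ v, (v, w) ∈ f.1}
  isCofinal f := by
    -- The "back" half is the "forth" half for the inverse.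
    obtain ⟨v, hv⟩ := f.symm.exists_across hG w
    have hv' : ∀ p ∈ f.1, (p.1 = v ↔ p.2 = w) ∧ (G.Adj p.1 v ↔ G.Adj p.2 w) := fun p hp =>
      have := hv p.swap (Finset.mem_image_of_mem _ hp)
      ⟨this.1.symm, this.2.symm⟩
    exact ⟨f.extend v w hv', ⟨v, Finset.mem_insert_self _ _⟩, f.le_extend v w hv'⟩

/-- Every finite partial automorphism of the Rado graph extends to an automorphism. -/
theorem exists_aut (hG : IsRado G) (f : PartialAut G) : ∃ σ : GAut G, ∀ p ∈ f.1, σ p.1 = p.2 := by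
  have := hG.countable
  cases nonempty_encodable V
  -- An ideal containing `f` and meeting these countably many cofinal sets is a directed family of
  -- partial automorphisms with total, surjective union.
  let D : V ⊕ V → Order.Cofinal (PartialAut G) := Sum.elim (definedAtLeft hG) (definedAtRight hG)
  let I := Order.idealOfCofinals f D
  have hF : ∀ v, ∃ w, ∃ g ∈ I, (v, w) ∈ g.1 := fun v => by
    obtain ⟨g, ⟨w, hw⟩, hg⟩ := Order.cofinal_meets_idealOfCofinals f D (Sum.inl v)
    exact ⟨w, g, hg, hw⟩
  have hH : ∀ w, ∃ v, ∃ g ∈ I, (v, w) ∈ g.1 := fun w => by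
    obtain ⟨g, ⟨v, hv⟩, hg⟩ := Order.cofinal_meets_idealOfCofinals f D (Sum.inr w)
    exact ⟨v, g, hg, hv⟩
  choose F hF using hF
  choose H hH using hH
  -- By directedness any two pairs lie in a single member of the ideal, so the union preserves and
  -- reflects equality and adjacency.
  have key : ∀ {v w v' w' : V}, (∃ g ∈ I, (v, w) ∈ g.1) → (∃ g ∈ I, (v', w') ∈ g.1) →
      (v = v' ↔ w = w') ∧ (G.Adj v v' ↔ G.Adj w w') := by
    rintro v w v' w' ⟨g, hg, h⟩ ⟨g', hg', h'⟩
    obtain ⟨m, -, hgm, hgm'⟩ := I.directed _ hg _ hg'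
    exact m.2 (v, w) (hgm h) (v', w') (hgm' h')
  refine ⟨⟨⟨F, H, fun v => ?_, fun w => ?_⟩, fun {v w} => ?_⟩, fun p hp => ?_⟩
  · exact (key (hH (F v)) (hF v)).1.2 rfl
  · exact (key (hF (H w)) (hH w)).1.1 rfl
  · exact (key (hF v) (hF w)).2.symm
  · exact (key (hF p.1) ⟨f, Order.mem_idealOfCofinals f D, hp⟩).1.1 rfl

end PartialAut

/-- `v` and `w` lie outside `A` and have the same neighbours in `A`. -/
def SameType (G : SimpleGraph V) (A : Finset V) (v w : V) : Prop :=
  v ∉ A ∧ w ∉ A ∧ ∀ a ∈ A, G.Adj v a ↔ G.Adj w a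

/-- The identity of `A` extended by the pair `(v, w)` is a partial automorphism, and homogeneity
applies. -/
theorem SameType.exists_aut (hG : IsRado G) {A : Finset V} {v w : V} (h : SameType G A v w) :
    ∃ σ : GAut G, Fixes σ A ∧ σ v = w := by
  obtain ⟨hv, hw, hadj⟩ := h
  let f : PartialAut G := ⟨A.image fun a => (a, a), fun p hp q hq => by
    obtain ⟨a, -, rfl⟩ := Finset.mem_image.1 hp
    obtain ⟨b, -, rfl⟩ := Finset.mem_image.1 hq
    simp⟩
  have hf : ∀ p ∈ f.1, (p.1 = v ↔ p.2 = w) ∧ (G.Adj p.1 v ↔ G.Adj p.2 w) := fun p hp => by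
    obtain ⟨a, ha, rfl⟩ := Finset.mem_image.1 hp
    refine ⟨iff_of_false ?_ ?_, ?_⟩
    · rintro rfl; exact hv ha
    · rintro rfl; exact hw ha
    · rw [G.adj_comm, G.adj_comm a]; exact hadj a ha
  obtain ⟨σ, hσ⟩ := (f.extend v w hf).exists_aut hG
  exact ⟨σ, fun a ha => hσ (a, a) (Finset.mem_insert_of_mem (Finset.mem_image_of_mem _ ha)),
    hσ (v, w) (Finset.mem_insert_self _ _)⟩

/-- Types are contained in orbits, so functions supported by `A` factor through types. This is what
turns integrals against ν_α into finite sums. -/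
theorem SameType.apply_eq (hG : IsRado G) {α : Type*} {φ : V → α} {A : Finset V}
    (hφ : ∀ σ : GAut G, Fixes σ A → ∀ x, φ (σ x) = φ x) {v w : V} (h : SameType G A v w) :
    φ v = φ w := by
  obtain ⟨σ, hσ, rfl⟩ := h.exists_aut hG
  exact (hφ σ hσ v).symm

/-- Pairs of vertices with the same type over `A` lie in the same orbit. -/
theorem SameType.apply_eq₂ (hG : IsRado G) {α : Type*} {φ : V → V → α} {A : Finset V}
    (hφ : ∀ σ : GAut G, Fixes σ A → ∀ x y, φ (σ x) (σ y) = φ x y) {v w v' w' : V}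
    (h : SameType G A v v') (h' : SameType G A w w') (hvw : v ≠ w) (hvw' : v' ≠ w')
    (hadj : G.Adj v w ↔ G.Adj v' w') : φ v w = φ v' w' := by
  obtain ⟨σ, hσ, rfl⟩ := h.exists_aut hG
  -- With the first vertex already in place, the second is moved by an automorphism fixing `A` and
  -- that vertex; the hypothesis on adjacency is exactly what equality of types over the larger set
  -- requires.
  have h2 : SameType G (insert (σ v) A) (σ w) w' := by
    refine ⟨?_, ?_, ?_⟩
    · rw [Finset.mem_insert, not_or]
      refine ⟨fun h => hvw (σ.injective h).symm, fun hA => h'.1 ?_⟩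
      have : σ (σ w) = σ w := hσ _ hA
      rwa [σ.injective this] at hA
    · rw [Finset.mem_insert, not_or]
      exact ⟨hvw'.symm, h'.2.1⟩
    · intro a ha
      rcases Finset.mem_insert.1 ha with rfl | ha
      · rw [G.adj_comm w', ← hadj, G.adj_comm v]
        exact σ.map_rel_iff
      · rw [← h'.2.2 a ha, ← hσ a ha]
        conv_rhs => rw [← σ.map_rel_iff, hσ a ha]
  obtain ⟨τ, hτ, rfl⟩ := h2.exists_aut hG
  have h1 : τ (σ v) = σ v := hτ _ (Finset.mem_insert_self _ _)
  rw [← hφ σ hσ v w, ← hφ τ (hτ.mono (Finset.subset_insert _ _)) (σ v) (σ w), h1]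

/-! ### Witnesses of types -/

theorem IsRado.exists_witness (hG : IsRado G) (A B : Finset V) :
    ∃ v, v ∉ A ∧ ∀ a ∈ A, G.Adj v a ↔ a ∈ B := by
  obtain ⟨v, h1, h2, h3, h4⟩ := hG.extension (A ∩ B) (A \ B) (by
    rw [Finset.disjoint_left]; intro a; simp +contextual)
  refine ⟨v, fun hv => ?_, fun a ha => ⟨fun h => ?_, fun h => h3 a (Finset.mem_inter.2 ⟨ha, h⟩)⟩⟩
  · by_cases hB : v ∈ B
    · exact h1 (Finset.mem_inter.2 ⟨hv, hB⟩)
    · exact h2 (Finset.mem_sdiff.2 ⟨hv, hB⟩)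
  · by_contra hB
    exact h4 a (Finset.mem_sdiff.2 ⟨ha, hB⟩) h

/-- A vertex outside `A` whose neighbours in `A` are those in `B`. -/
def IsRado.wit (hG : IsRado G) (A B : Finset V) : V := (hG.exists_witness A B).choose

theorem IsRado.wit_notMem (hG : IsRado G) (A B : Finset V) : hG.wit A B ∉ A :=
  (hG.exists_witness A B).choose_spec.1

theorem IsRado.adj_wit (hG : IsRado G) {A : Finset V} (B : Finset V) {a : V} (ha : a ∈ A) :
    G.Adj (hG.wit A B) a ↔ a ∈ B :=
  (hG.exists_witness A B).choose_spec.2 a ha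

/-! ### The Erdős–Rényi measure -/

/-- The weight of the type over `A` with neighbours `B`. -/
def weight (α : unitInterval) (A B : Finset V) : ℝ≥0∞ :=
  ∏ a ∈ A, if a ∈ B then ENNReal.ofReal α else ENNReal.ofReal (1 - α)

theorem ofReal_add_ofReal_one_sub (α : unitInterval) :
    ENNReal.ofReal α + ENNReal.ofReal (1 - α) = 1 := by
  rw [← ENNReal.ofReal_add α.2.1 (by linarith [α.2.2])]
  simp

theorem weight_insert_insert (α : unitInterval) {A : Finset V} {a : V} (ha : a ∉ A) (B : Finset V) :
    weight α (insert a A) (insert a B) = ENNReal.ofReal α * weight α A B := by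
  rw [weight, Finset.prod_insert ha, if_pos (Finset.mem_insert_self _ _)]
  congr 1
  refine Finset.prod_congr rfl fun b hb => ?_
  have : b ≠ a := fun h => ha (h ▸ hb)
  simp [this]

theorem weight_insert (α : unitInterval) {A : Finset V} {a : V} (ha : a ∉ A) {B : Finset V}
    (hB : a ∉ B) : weight α (insert a A) B = ENNReal.ofReal (1 - α) * weight α A B := by
  rw [weight, Finset.prod_insert ha, if_neg hB, weight]

/-- The expectation over the types over `A`. -/
def expect (hG : IsRado G) (α : unitInterval) (A : Finset V) (φ : V → ℝ≥0∞) : ℝ≥0∞ :=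
  ∑ B ∈ A.powerset, weight α A B * φ (hG.wit A B)

/-- Each type over `A` gives two types over `insert a A`: not adjacent to `a`, and adjacent to `a`.
-/
theorem expect_insert (hG : IsRado G) (α : unitInterval) {A : Finset V} {a : V} (ha : a ∉ A)
    (φ : V → ℝ≥0∞) : expect hG α (insert a A) φ =
      ∑ B ∈ A.powerset, weight α A B * (ENNReal.ofReal (1 - α) * φ (hG.wit (insert a A) B) +
        ENNReal.ofReal α * φ (hG.wit (insert a A) (insert a B))) := by
  rw [expect, Finset.sum_powerset_insert ha, ← Finset.sum_add_distrib]
  refine Finset.sum_congr rfl fun B hB => ?_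
  rw [weight_insert_insert α ha, weight_insert α ha fun h => ha (Finset.mem_powerset.1 hB h)]
  ring

/-- The two refinements of a type over `A` still have that type over `A`, so `φ` takes the same
value on both, and their relative weights 1 - α and α add up to 1. -/
theorem expect_eq_insert (hG : IsRado G) (α : unitInterval) {A : Finset V} {φ : V → ℝ≥0∞}
    (hφ : ∀ σ : GAut G, Fixes σ A → ∀ x, φ (σ x) = φ x) (a : V) :
    expect hG α (insert a A) φ = expect hG α A φ := by
  by_cases ha : a ∈ A
  · rw [Finset.insert_eq_of_mem ha]
  rw [expect_insert hG α ha, expect]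
  refine Finset.sum_congr rfl fun B hB => ?_
  have h : ∀ C, (∀ b ∈ A, b ∈ C ↔ b ∈ B) → φ (hG.wit (insert a A) C) = φ (hG.wit A B) := by
    refine fun C hC => SameType.apply_eq hG hφ ⟨fun h => ?_, hG.wit_notMem _ _, fun b hb => ?_⟩
    · exact hG.wit_notMem _ _ (Finset.mem_insert_of_mem h)
    · rw [hG.adj_wit _ hb, hG.adj_wit _ (Finset.mem_insert_of_mem hb), hC b hb]
  rw [h B fun _ _ => Iff.rfl, h (insert a B), ← add_mul, add_comm, ofReal_add_ofReal_one_sub,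
    one_mul]
  intro b hb
  have : b ≠ a := fun h => ha (h ▸ hb)
  simp [this]

theorem expect_union (hG : IsRado G) (α : unitInterval) {A : Finset V} {φ : V → ℝ≥0∞}
    (hφ : ∀ σ : GAut G, Fixes σ A → ∀ x, φ (σ x) = φ x) (B : Finset V) :
    expect hG α (B ∪ A) φ = expect hG α A φ := by
  induction B using Finset.induction_on with
  | empty => rw [Finset.empty_union]
  | insert b B _ ih =>
    rw [Finset.insert_union, expect_eq_insert hG α _ b, ih]
    exact fun σ h => hφ σ (h.mono Finset.subset_union_right)

/-- Both sides equal the expectation over `A ∪ B`. Hence the expectation of a function is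
independent of the support used to compute it. -/
theorem expect_eq (hG : IsRado G) (α : unitInterval) {A B : Finset V} {φ : V → ℝ≥0∞}
    (hA : ∀ σ : GAut G, Fixes σ A → ∀ x, φ (σ x) = φ x)
    (hB : ∀ σ : GAut G, Fixes σ B → ∀ x, φ (σ x) = φ x) :
    expect hG α A φ = expect hG α B φ := by
  rw [← expect_union hG α hB A, Finset.union_comm, expect_union hG α hA]

theorem expect_one (hG : IsRado G) (α : unitInterval) (A : Finset V) :
    expect hG α A (fun _ => 1) = 1 := by
  have h := expect_union hG α (A := ∅) (φ := fun _ => 1) (fun _ _ _ => rfl) A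
  rw [Finset.union_empty] at h
  rw [h]
  simp [expect, weight]

/-! ### Construction of ν_α from the expectations over types -/

theorem indicator_supp {X : NomSet G} {S : Set X} {A : Finset V} (hA : Supports G A S)
    (σ : GAut G) (hσ : Fixes σ A) (x : X) :
    S.indicator (1 : X → ℝ≥0∞) (σ • x) = S.indicator 1 x := by
  have := supports_set_iff.1 hA σ hσ x
  by_cases hx : x ∈ S
  · rw [Set.indicator_of_mem hx, Set.indicator_of_mem (this.2 hx)]; rfl
  · rw [Set.indicator_of_notMem hx, Set.indicator_of_notMem (fun h => hx (this.1 h))]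

/-- A chosen finite support of an event. -/
def Event.supp {X : NomSet G} (S : Event X) : Finset V := S.2.choose

theorem Event.supports_supp {X : NomSet G} (S : Event X) : Supports G S.supp S.1 := S.2.choose_spec

/-- Exchanges the arbitrarily chosen support of an event for any convenient one, such as a support
common to a whole sequence of events. -/
theorem expect_event_eq (hG : IsRado G) (α : unitInterval) (S : Event (vertices G)) {A : Finset V}
    (hA : Supports G A S.1) :
    expect hG α S.supp (S.1.indicator 1) = expect hG α A (S.1.indicator 1) :=
  expect_eq hG α (indicator_supp (X := vertices G) S.supports_supp)
    (indicator_supp (X := vertices G) hA)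

/-- An automorphism carries types over `A` to types over its image and preserves their weights.
Chosen witnesses need not be carried to chosen witnesses, but they have the same type, which is
enough for `φ`. -/
theorem expect_image (hG : IsRado G) (α : unitInterval) {A : Finset V} {φ : V → ℝ≥0∞}
    (hφ : ∀ τ : GAut G, Fixes τ A → ∀ x, φ (τ x) = φ x) (σ : GAut G) :
    expect hG α (A.image σ) (fun v => φ (σ⁻¹ v)) = expect hG α A φ := by
  symm
  refine Finset.sum_bij (fun B _ => B.image σ) (fun B hB => ?_) (fun B _ C _ h => ?_)
    (fun C hC => ?_) fun B hB => ?_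
  · exact Finset.mem_powerset.2 (Finset.image_subset_image (Finset.mem_powerset.1 hB))
  · exact Finset.image_injective σ.injective h
  · obtain ⟨B, hB, rfl⟩ := Finset.subset_image_iff.1 (Finset.mem_powerset.1 hC)
    exact ⟨B, Finset.mem_powerset.2 (by exact_mod_cast hB), rfl⟩
  · congr 1
    · rw [weight, weight, Finset.prod_image fun _ _ _ _ h => σ.injective h]
      refine Finset.prod_congr rfl fun a _ => ?_
      have : (σ a ∈ B.image σ) ↔ a ∈ B := by simp
      simp only [this]
    · refine SameType.apply_eq hG hφ ⟨hG.wit_notMem _ _, fun h => ?_, fun a ha => ?_⟩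
      · refine hG.wit_notMem (A.image σ) (B.image σ) ?_
        refine Finset.mem_image.2 ⟨_, h, RelIso.apply_inv_self σ _⟩
      · rw [hG.adj_wit _ ha, ← σ.map_rel_iff, RelIso.apply_inv_self,
          hG.adj_wit _ (Finset.mem_image_of_mem σ ha)]
        simp

/-- The Erdős–Rényi measure `ν_α` on the vertices of the Rado graph. -/
def erdosRenyi (hG : IsRado G) (α : unitInterval) : Prob (vertices G) where
  toFun S := expect hG α S.supp (S.1.indicator 1)
  finSupp := by
    refine ⟨∅, fun σ _ S => ?_⟩
    rw [expect_event_eq hG α (σ • S) (supports_smul S.supports_supp σ),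
      ← expect_image hG α (indicator_supp (X := vertices G) S.supports_supp) σ]
    congr 1
    ext v
    have : v ∈ (σ • S).1 ↔ σ⁻¹ v ∈ S.1 := Set.mem_smul_set_iff_inv_smul_mem
    simp only [Set.indicator_apply, this, Pi.one_apply]
  additive S U := by
    rintro ⟨A, hA⟩ hd hU
    have hUA : Supports G A U.1 := by
      rw [hU]; exact @MeasurableSet.iUnion _ _ (suppAlg (vertices G) A) _ _ hA
    -- The common support is essential here: over it all the values come from one finite combination
    -- of Dirac measures, and additivity is inherited term by term.
    rw [expect_event_eq hG α U hUA, tsum_congr fun i => expect_event_eq hG α (S i) (hA i)]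
    simp only [expect]
    rw [Summable.tsum_finsetSum fun _ _ => ENNReal.summable]
    refine Finset.sum_congr rfl fun B _ => ?_
    rw [ENNReal.tsum_mul_left]
    congr 1
    have h := (dirac (X := vertices G) (hG.wit A B)).additive S U ⟨A, hA⟩ hd hU
    exact h
  univ U hU := by
    rw [hU, Set.indicator_univ]
    exact expect_one hG α _

theorem erdosRenyi_toFun (hG : IsRado G) (α : unitInterval) (S : Event (vertices G)) {A : Finset V}
    (hA : Supports G A S.1) : (erdosRenyi hG α).toFun S = expect hG α A (S.1.indicator 1) :=
  expect_event_eq hG α S hA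

/-- Integration against `ν_α`. -/
theorem int_erdosRenyi (hG : IsRado G) (α : unitInterval) {A : Finset V} {φ : V → ℝ≥0∞}
    (hφ : ∀ σ : GAut G, Fixes σ A → ∀ x, φ (σ x) = φ x) :
    (erdosRenyi hG α).int φ = expect hG α A φ := by
  have hm := measurable_of_supp (X := vertices G) hφ
  rw [(erdosRenyi hG α).int_eq hφ]
  let m := suppAlg (vertices G) A
  -- On the events supported by `A`, ν_α is a finite combination of Dirac measures at witnesses of
  -- the types.
  rw [show (erdosRenyi hG α).measure A =
      ∑ B ∈ A.powerset, weight α A B • @Measure.dirac (vertices G) m (hG.wit A B) from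
    @Measure.ext (vertices G) m _ _ fun S hS => by
      rw [Prob.measure_apply _ hS, erdosRenyi_toFun hG α ⟨S, A, hS⟩ hS, Measure.finsetSum_apply]
      refine Finset.sum_congr rfl fun B _ => ?_
      rw [Measure.smul_apply, Measure.dirac_apply' _ hS, smul_eq_mul]]
  rw [lintegral_finsetSum_measure]
  refine Finset.sum_congr rfl fun B _ => ?_
  rw [lintegral_smul_measure, lintegral_dirac' _ hm, smul_eq_mul]

theorem isErdosRenyi_erdosRenyi (hG : IsRado G) (α : unitInterval) :
    IsErdosRenyi G α (erdosRenyi hG α) where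
  equivariant σ := Prob.ext_int fun φ hφ => by
    obtain ⟨A, hA⟩ := id hφ
    rw [Prob.smul_int _ _ hφ]
    have h2 : ∀ τ : GAut G, Fixes τ (A.image (σ⁻¹ : GAut G)) → ∀ x : V, φ (σ (τ x)) = φ (σ x) := fun τ hτ x => by
      have := hA _ hτ.conj (σ • x)
      refine Eq.trans ?_ this
      change φ (σ (τ x)) = φ ((σ⁻¹)⁻¹ (τ (σ⁻¹ (σ x))))
      rw [inv_inv, RelIso.inv_apply_self]
    rw [int_erdosRenyi hG α (A := A.image (σ⁻¹ : GAut G)) h2, int_erdosRenyi hG α (A := A) hA,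
      ← expect_image hG α hA σ⁻¹]
    simp only [inv_inv]
    rfl
  formula S A hA v hv := by
    rw [erdosRenyi_toFun hG α S hA, expect, ENNReal.ofReal_sum_of_nonneg]
    · refine Finset.sum_congr rfl fun B hB => ?_
      have hvB := hv B (Finset.mem_powerset.1 hB)
      rw [ENNReal.ofReal_mul (by split_ifs <;> norm_num), mul_comm]
      congr 1
      -- The chosen witness is traded for the given `v B`, which has the same type over `A`.
      · rw [SameType.apply_eq hG (indicator_supp (X := vertices G) hA) (w := v B)
          ⟨hG.wit_notMem _ _, hvB.1, fun a ha => by rw [hG.adj_wit _ ha, hvB.2 a ha]⟩]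
        by_cases h : v B ∈ S.1 <;> simp [h]
      · rw [weight, ENNReal.ofReal_prod_of_nonneg]
        · refine Finset.prod_congr rfl fun a ha => ?_
          simp only [hvB.2 a ha, apply_ite ENNReal.ofReal]
        · intro a _
          split_ifs
          exacts [α.2.1, sub_nonneg.2 α.2.2]
    · intro B _
      refine mul_nonneg (by split_ifs <;> norm_num) (Finset.prod_nonneg fun a _ => ?_)
      split_ifs
      exacts [α.2.1, sub_nonneg.2 α.2.2]

/-! ### Linearity of internal integration -/

/-- Over a common support the internal integrals become Lebesgue integrals for one σ-algebra. -/
theorem Prob.int_add {X : NomSet G} (μ : Prob X) {φ ψ : X → ℝ≥0∞} (hφ : FS φ) (hψ : FS ψ) :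
    μ.int (fun x => φ x + ψ x) = μ.int φ + μ.int ψ := by
  obtain ⟨A, hA⟩ := hφ
  obtain ⟨B, hB⟩ := hψ
  have hA' : ∀ σ : GAut G, Fixes σ (A ∪ B) → ∀ x, φ (σ • x) = φ x := fun σ h => hA σ h.of_union_left
  have hB' : ∀ σ : GAut G, Fixes σ (A ∪ B) → ∀ x, ψ (σ • x) = ψ x := fun σ h => hB σ h.of_union_right
  rw [μ.int_eq hA', μ.int_eq hB', μ.int_eq (A := A ∪ B) fun σ h x => by rw [hA' σ h, hB' σ h]]
  exact @lintegral_add_left X (suppAlg X (A ∪ B)) _ _ (measurable_of_supp hA') _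

theorem Prob.int_const_mul {X : NomSet G} (μ : Prob X) (c : ℝ≥0∞) {φ : X → ℝ≥0∞} (hφ : FS φ) :
    μ.int (fun x => c * φ x) = c * μ.int φ := by
  obtain ⟨A, hA⟩ := hφ
  rw [μ.int_eq hA, μ.int_eq (A := A) fun σ h x => by rw [hA σ h]]
  exact @lintegral_const_mul X (suppAlg X A) _ _ _ (measurable_of_supp hA)

theorem FS.const_mul {X : NomSet G} (c : ℝ≥0∞) {φ : X → ℝ≥0∞} (hφ : FS φ) :
    FS (fun x => c * φ x) := by
  obtain ⟨A, hA⟩ := hφ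
  exact ⟨A, fun σ h x => congrArg (c * ·) (hA σ h x)⟩

/-- An event of a nominal set with trivial action. -/
def trivEvent {X : NomSet G} (hX : ∀ (σ : GAut G) (x : X), σ • x = x) (S : Set X) : Event X :=
  ⟨S, ∅, supports_set_iff.2 fun σ _ x => by rw [hX]⟩

/-- Under the trivial action every subset is supported by `∅`, so the internal measure is a measure
on a finite discrete space. -/
theorem Prob.int_trivial {X : NomSet G} (hX : ∀ (σ : GAut G) (x : X), σ • x = x) [Fintype X]
    (μ : Prob X) (φ : X → ℝ≥0∞) : μ.int φ = ∑ x, φ x * μ.toFun (trivEvent hX {x}) := by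
  rw [μ.int_eq (A := ∅) fun σ _ x => by rw [hX]]
  let m := suppAlg X ∅
  have : MeasurableSingletonClass X := ⟨fun x => supports_set_iff.2 fun σ _ y => by rw [hX]⟩
  rw [lintegral_fintype]
  refine Finset.sum_congr rfl fun x _ => ?_
  rw [Prob.measure_apply _ (measurableSet_singleton x)]
  rfl

theorem two_trivial (σ : GAut G) (x : two G) : σ • x = x := by
  rcases x with x | x <;> rfl

theorem int_bernoulli (r : unitInterval) (φ : two G → ℝ≥0∞) :
    (bernoulli G r).int φ =
      ENNReal.ofReal r * φ (Sum.inl ()) + ENNReal.ofReal (1 - r) * φ (Sum.inr ()) := by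
  let _ : Fintype (two G) := inferInstanceAs (Fintype (Unit ⊕ Unit))
  rw [Prob.int_trivial two_trivial]
  have h : ∀ f : Unit ⊕ Unit → ℝ≥0∞, ∑ x, f x = f (Sum.inl ()) + f (Sum.inr ()) := by simp
  refine (h _).trans ?_
  change φ (Sum.inl ()) * (ENNReal.ofReal r * Set.indicator {Sum.inl ()} 1 (Sum.inl ()) +
      ENNReal.ofReal (1 - r) * Set.indicator {Sum.inl ()} 1 (Sum.inr ())) +
    φ (Sum.inr ()) * (ENNReal.ofReal r * Set.indicator {Sum.inr ()} 1 (Sum.inl ()) +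
      ENNReal.ofReal (1 - r) * Set.indicator {Sum.inr ()} 1 (Sum.inr ())) = _
  simp [mul_comm]

/-! ### Commutation of measures and the commutant -/

/-- Two internal measures commute if the order of integration is irrelevant. -/
def Commuting {X Y : NomSet G} (μ : Prob X) (ν : Prob Y) : Prop :=
  ∀ φ : prod X Y → ℝ≥0∞, FS φ →
    μ.int (fun x => ν.int fun y => φ (x, y)) = ν.int (fun y => μ.int fun x => φ (x, y))

theorem Commuting.symm {X Y : NomSet G} {μ : Prob X} {ν : Prob Y} (h : Commuting μ ν) :
    Commuting ν μ := fun φ hφ =>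
  (h (fun p => φ (p.2, p.1)) (hφ.comp (X := prod X Y) (u := fun p => (p.2, p.1))
    fun _ _ => rfl)).symm

theorem Commuting.smul {X Y : NomSet G} {μ : Prob X} {ν : Prob Y} (h : Commuting μ ν)
    (σ : GAut G) : Commuting (σ • μ) (σ • ν) := fun φ hφ => by
  rw [Prob.smul_int _ _ (hφ.int_snd _), Prob.smul_int _ _ (hφ.int_fst _)]
  simp_rw [Prob.smul_int _ _ (hφ.curry _), Prob.smul_int _ _ (hφ.curry' _)]
  exact h (fun p => φ (σ • p)) (hφ.smul σ)

/-- The measures commuting with all the members of a family closed under automorphisms. -/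
def commutant (L : ∀ X : NomSet G, Set (Prob X))
    (hL : ∀ (X : NomSet G) (σ : GAut G), ∀ μ ∈ L X, σ • μ ∈ L X) : StrongSubmonad G where
  mem X := {μ | ∀ (Y : NomSet G), ∀ ν ∈ L Y, Commuting μ ν}
  smul_mem X σ μ hμ Y ν hν := by
    -- Invariance of `L` enters here: `μ` commutes with `σ⁻¹ • ν`, so `σ • μ` commutes with `ν`.
    have := (hμ Y _ (hL Y σ⁻¹ ν hν)).smul σ
    rwa [smul_inv_smul] at this
  dirac_mem X x Y ν _ φ hφ := by
    rw [int_dirac _ (hφ.int_snd _)]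
    simp_rw [int_dirac _ (hφ.curry' _)]
  bind_mem X Y μ k hk hμ hkm Z ν hν φ hφ := by
    rw [int_bind _ _ _ (hφ.int_snd _)]
    simp_rw [int_bind _ _ _ (hφ.curry' _)]
    -- Two exchanges: each `k x` with `ν`, then `μ` with `ν`. The second needs the integral over `k
    -- x` to be finitely supported jointly in `x` and the variable of `ν`.
    have h1 : ∀ x, (k x).int (fun y => ν.int fun z => φ (y, z)) =
        ν.int (fun z => (k x).int fun y => φ (y, z)) := fun x => hkm x Z ν hν φ hφ
    simp_rw [h1]
    refine hμ Z ν hν (fun p => (k p.1).int fun y => φ (y, p.2)) ?_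
    obtain ⟨A, hA⟩ := hk
    obtain ⟨B, hB⟩ := id hφ
    refine ⟨A ∪ B, fun σ h p => ?_⟩
    have e1 : k (σ • p).1 = σ • k p.1 := hA σ h.of_union_left p.1
    change (k (σ • p).1).int (fun y => φ (y, (σ • p).2)) = _
    rw [e1, Prob.smul_int _ _ (hφ.curry' _)]
    exact congrArg (k p.1).int (funext fun y => hB σ h.of_union_right (y, p.2))

theorem StrongSubmonad.generate_le {gens : ∀ X : NomSet G, Set (Prob X)} {T : StrongSubmonad G}
    (h : ∀ X, gens X ⊆ T.mem X) (X : NomSet G) : (generate gens).mem X ⊆ T.mem X :=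
  fun _ hμ => hμ T h

/-- A strong submonad generated by pairwise commuting measures is commutative. -/
theorem StrongSubmonad.generate_isCommutative (gens : ∀ X : NomSet G, Set (Prob X))
    (hg : ∀ (X : NomSet G) (σ : GAut G), ∀ μ ∈ gens X, σ • μ ∈ gens X)
    (hc : ∀ X Y : NomSet G, ∀ μ ∈ gens X, ∀ ν ∈ gens Y, Commuting μ ν) :
    (generate gens).IsCommutative where
  comm {X₁ X₂ X₃} f g x := by
    -- The generated submonad lies in the commutant of the generators.
    have h1 := generate_le (T := commutant gens hg) fun X μ hμ Y ν hν => hc X Y μ hμ ν hν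
    -- By symmetry each generator commutes with the whole generated submonad, which therefore lies
    -- in its own commutant.
    have h2 := generate_le (gens := gens) (T := commutant _ (generate gens).smul_mem)
      fun X μ hμ Y ν hν => (h1 Y hν X μ hμ).symm
    refine Prob.ext_int fun φ hφ => ?_
    rw [int_pairL _ _ hφ, int_pairR _ _ hφ]
    exact h2 X₂ (f.mem x) X₃ _ (g.mem x) φ hφ

/-! ### Commutativity of the Erdős–Rényi monad -/

/-- An integral against a Bernoulli measure is a combination of two values, so the exchange is
linearity of `ν`. -/
theorem commuting_bernoulli {Y : NomSet G} (r : unitInterval) (ν : Prob Y) :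
    Commuting (bernoulli G r) ν := fun φ hφ => by
  simp_rw [int_bernoulli]
  rw [Prob.int_add _ ((hφ.curry _).const_mul _) ((hφ.curry _).const_mul _),
    Prob.int_const_mul _ _ (hφ.curry _), Prob.int_const_mul _ _ (hφ.curry _)]

theorem smul_bernoulli (σ : GAut G) (r : unitInterval) : σ • bernoulli G r = bernoulli G r :=
  Prob.ext_int fun φ hφ => by
    rw [Prob.smul_int _ _ hφ]
    congr 1
    funext x
    rw [two_trivial]

/-- The double integral against `ν_α`, computed over a support of the integrand. -/
theorem int_int_erdosRenyi (hG : IsRado G) (α : unitInterval) {A : Finset V} {φ : V → V → ℝ≥0∞}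
    (hφ : ∀ σ : GAut G, Fixes σ A → ∀ x y, φ (σ x) (σ y) = φ x y) :
    (erdosRenyi hG α).int (fun x => (erdosRenyi hG α).int (φ x)) =
      ∑ B ∈ A.powerset, ∑ C ∈ A.powerset, weight α A B * (weight α A C *
        (ENNReal.ofReal (1 - α) * φ (hG.wit A B) (hG.wit (insert (hG.wit A B) A) C) +
        ENNReal.ofReal α *
          φ (hG.wit A B) (hG.wit (insert (hG.wit A B) A) (insert (hG.wit A B) C)))) := by
  have hFS : FS (X := prod (vertices G) (vertices G)) fun p => φ p.1 p.2 :=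
    ⟨A, fun σ h p => hφ σ h p.1 p.2⟩
  have h1 : ∀ σ : GAut G, Fixes σ A → ∀ x : V,
      (erdosRenyi hG α).int (φ (σ x)) = (erdosRenyi hG α).int (φ x) := fun σ h x => by
    conv_lhs => rw [← (isErdosRenyi_erdosRenyi hG α).equivariant σ]
    rw [Prob.smul_int _ _ (hFS.curry (X := vertices G) (Y := vertices G) (σ x))]
    exact congrArg _ (funext fun y => hφ σ h x y)
  rw [int_erdosRenyi hG α (A := A) h1, expect]
  refine Finset.sum_congr rfl fun B _ => ?_
  -- With the first vertex fixed at its witness, the integrand is supported by `A` together with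
  -- that vertex. Splitting along it separates the two possible adjacencies of the pair.
  rw [int_erdosRenyi hG α (A := insert (hG.wit A B) A) fun σ h y => ?_,
    expect_insert hG α (hG.wit_notMem A B), Finset.mul_sum]
  have e : σ (hG.wit A B) = hG.wit A B := h _ (Finset.mem_insert_self _ _)
  conv_lhs => rw [← e]
  exact hφ σ (h.mono (Finset.subset_insert _ _)) _ _

/-- In either order the double integral is a sum over two types over `A` and one adjacency. The
weights agree, and the pairs of witnesses with the same data lie in one orbit over `A`, whichever
vertex was drawn first. -/
theorem commuting_erdosRenyi (hG : IsRado G) (α : unitInterval) :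
    Commuting (erdosRenyi hG α) (erdosRenyi hG α) := fun φ hφ => by
  obtain ⟨A, hA⟩ := hφ
  have hA' : ∀ σ : GAut G, Fixes σ A → ∀ x y : V, φ (σ x, σ y) = φ (x, y) :=
    fun σ h x y => hA σ h (x, y)
  refine (int_int_erdosRenyi hG α (φ := fun x y => φ (x, y)) hA').trans (Eq.symm ?_)
  refine (int_int_erdosRenyi hG α (φ := fun y x => φ (x, y)) fun σ h x y => hA' σ h y x).trans ?_
  -- Aligns the sums by coordinate of `φ` instead of by order of drawing.
  rw [Finset.sum_comm]
  refine Finset.sum_congr rfl fun B hB => Finset.sum_congr rfl fun C hC => ?_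
  rw [mul_left_comm]
  -- A neighbour set contained in `A` cannot contain the earlier witness, so over the enlarged set
  -- it prescribes non-adjacency to it.
  have hnot : ∀ D ∈ A.powerset, ∀ E, hG.wit A E ∉ D := fun D hD E h =>
    hG.wit_notMem A E (Finset.mem_powerset.1 hD h)
  have hty : ∀ D E F, (∀ a ∈ A, a ∈ F ↔ a ∈ E) →
      SameType G A (hG.wit (insert (hG.wit A D) A) F) (hG.wit A E) := fun D E F hF =>
    ⟨fun h => hG.wit_notMem _ _ (Finset.mem_insert_of_mem h), hG.wit_notMem _ _, fun a ha => by
      rw [hG.adj_wit _ (Finset.mem_insert_of_mem ha), hG.adj_wit _ ha, hF a ha]⟩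
  have hty' : ∀ D E F, (∀ a ∈ A, a ∈ F ↔ a ∈ E) →
      SameType G A (hG.wit A E) (hG.wit (insert (hG.wit A D) A) F) := fun D E F hF =>
    ⟨(hty D E F hF).2.1, (hty D E F hF).1, fun a ha => ((hty D E F hF).2.2 a ha).symm⟩
  have hne : ∀ D F, hG.wit (insert (hG.wit A D) A) F ≠ hG.wit A D := fun D F h =>
    hG.wit_notMem (insert (hG.wit A D) A) F (h.symm ▸ Finset.mem_insert_self _ _)
  have hins : ∀ D E : Finset V, ∀ a ∈ A, a ∈ insert (hG.wit A D) E ↔ a ∈ E := fun D E a ha => by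
    have : a ≠ hG.wit A D := fun h => hG.wit_notMem A D (h ▸ ha)
    simp [this]
  congr 2
  congr 2
  · refine SameType.apply_eq₂ hG (φ := fun x y => φ (x, y)) hA' (hty _ _ _ fun _ _ => Iff.rfl)
      (hty' _ _ _ fun _ _ => Iff.rfl) (hne _ _) (hne _ _).symm ?_
    rw [G.adj_comm (hG.wit A B), hG.adj_wit _ (Finset.mem_insert_self _ _),
      hG.adj_wit _ (Finset.mem_insert_self _ _)]
    exact iff_of_false (hnot _ hB _) (hnot _ hC _)
  · refine SameType.apply_eq₂ hG (φ := fun x y => φ (x, y)) hA' (hty _ _ _ (hins _ _))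
      (hty' _ _ _ (hins _ _)) (hne _ _) (hne _ _).symm ?_
    rw [G.adj_comm (hG.wit A B), hG.adj_wit _ (Finset.mem_insert_self _ _),
      hG.adj_wit _ (Finset.mem_insert_self _ _)]
    exact iff_of_true (Finset.mem_insert_self _ _) (Finset.mem_insert_self _ _)

theorem erMonad_isCommutative (hG : IsRado G) (α : unitInterval) :
    (erMonad (erdosRenyi hG α)).IsCommutative := by
  refine StrongSubmonad.generate_isCommutative _ ?_ ?_
  · rintro X σ μ (_ | r)
    · rw [Set.mem_ofPred_eq, (isErdosRenyi_erdosRenyi hG α).equivariant]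
      exact .nu
    · rw [Set.mem_ofPred_eq, smul_bernoulli]
      exact .bern r
  · rintro X Y μ (_ | r) ν (_ | s)
    · exact commuting_erdosRenyi hG α
    · exact (commuting_bernoulli _ _).symm
    · exact commuting_bernoulli _ _
    · exact commuting_bernoulli _ _

variable {T : StrongSubmonad G}

/-! ### Numerals in the Kleisli category -/

theorem KlHom.comp_pure_left [T.IsCommutative] {Y Z : Kl T} (y : Y.obj)
    (hy : Equivariant (X := one G) fun _ => y) (f : Y ⟶ Z) :
    KlHom.toFun ((show (𝟙_ (Kl T)) ⟶ Y from KlHom.pure T (X := one G) (fun _ => y) hy) ≫ f) () =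
      KlHom.toFun f y :=
  congrFun (KlHom.pure_comp_left (X := one G) (fun _ => y) hy f) ()

/-- The events of a nominal set with trivial action separate the points. -/
theorem dirac_eq_iff {X : NomSet G} (hX : ∀ (σ : GAut G) (x : X), σ • x = x) {x y : X} :
    dirac y = dirac x ↔ y = x := by
  refine ⟨fun h => ?_, fun h => h ▸ rfl⟩
  by_contra hne
  have h1 := congrArg (fun μ => Prob.toFun μ (trivEvent hX {x})) h
  have h2 : Set.indicator {x} (1 : X → ℝ≥0∞) y = Set.indicator {x} 1 x := h1
  rw [Set.indicator_of_notMem (by simpa using hne), Set.indicator_of_mem (Set.mem_singleton x)] at h2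
  exact zero_ne_one h2

section

variable [T.IsCommutative]

variable (T) in
/-- The points of the numerals. -/
def numPt : (n : ℕ) → Fin n → (num (Kl T) n).obj
  | 0 => Fin.elim0
  | n + 1 => Fin.lastCases (motive := fun _ => (num (Kl T) (n + 1)).obj)
      (Sum.inr () : sum (num (Kl T) n).obj (one G))
      fun i => (Sum.inl (numPt n i) : sum (num (Kl T) n).obj (one G))

theorem numPt_castSucc (n : ℕ) (i : Fin n) :
    numPt T (n + 1) i.castSucc = (Sum.inl (numPt T n i) : sum (num (Kl T) n).obj (one G)) :=
  Fin.lastCases_castSucc ..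

theorem numPt_last (n : ℕ) :
    numPt T (n + 1) (Fin.last n) = (Sum.inr () : sum (num (Kl T) n).obj (one G)) :=
  Fin.lastCases_last ..

theorem num_trivial : ∀ (n : ℕ) (σ : GAut G) (x : (num (Kl T) n).obj), σ • x = x
  | 0, _, x => Empty.elim x
  | n + 1, σ, x => by
    change sum (num (Kl T) n).obj (one G) at x
    rcases x with x | x
    · exact congrArg Sum.inl (num_trivial n σ x)
    · rfl

theorem numPt_bijective : ∀ n, Function.Bijective (numPt T n)
  | 0 => ⟨fun i => i.elim0, fun x => Empty.elim x⟩
  | n + 1 => by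
    constructor
    · intro i j
      refine Fin.lastCases ?_ (fun i => ?_) i <;> refine Fin.lastCases ?_ (fun j => ?_) j
      · exact fun _ => rfl
      · rw [numPt_last, numPt_castSucc]
        exact fun h => nomatch h
      · rw [numPt_last, numPt_castSucc]
        exact fun h => nomatch h
      · rw [numPt_castSucc, numPt_castSucc]
        exact fun h => congrArg Fin.castSucc ((numPt_bijective n).1 (Sum.inl_injective h))
    · intro x
      change sum (num (Kl T) n).obj (one G) at x
      rcases x with x | x
      · obtain ⟨i, rfl⟩ := (numPt_bijective n).2 x
        exact ⟨i.castSucc, numPt_castSucc n i⟩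
      · exact ⟨Fin.last n, numPt_last n⟩

variable (T) in
/-- The points of a numeral, as a bijection. -/
def numEquiv (n : ℕ) : Fin n ≃ (num (Kl T) n).obj := Equiv.ofBijective _ (numPt_bijective n)

theorem pt_last (n : ℕ) :
    pt (Kl T) (n + 1) (Fin.last n) = inr (num (Kl T) n) (𝟙_ (Kl T)) :=
  Fin.lastCases_last (motive := fun _ => 𝟙_ (Kl T) ⟶ num (Kl T) (n + 1))

theorem pt_castSucc (n : ℕ) (i : Fin n) :
    pt (Kl T) (n + 1) i.castSucc = pt (Kl T) n i ≫ inl (num (Kl T) n) (𝟙_ (Kl T)) :=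
  Fin.lastCases_castSucc (motive := fun _ => 𝟙_ (Kl T) ⟶ num (Kl T) (n + 1)) i

theorem pt_eq : ∀ (n : ℕ) (i : Fin n), pt (Kl T) n i =
    KlHom.pure T (X := one G) (fun _ => numPt T n i) fun σ _ => (num_trivial n σ _).symm
  | 0, i => i.elim0
  | n + 1, i => by
    refine Fin.lastCases ?_ (fun i => ?_) i
    · rw [pt_last]
      refine KlHom.ext (funext fun _ => ?_)
      exact congrArg dirac (numPt_last n).symm
    · rw [pt_castSucc, pt_eq n i]
      refine (KlHom.pure_comp ..).trans (KlHom.ext (funext fun _ => ?_))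
      exact congrArg dirac (numPt_castSucc n i).symm

theorem pt_toFun (n : ℕ) (i : Fin n) : KlHom.toFun (pt (Kl T) n i) () = dirac (numPt T n i) := by
  rw [pt_eq]; rfl

theorem pt_comp_toFun {X : Kl T} (n : ℕ) (i : Fin n) (f : num (Kl T) n ⟶ X) :
    KlHom.toFun (pt (Kl T) n i ≫ f) () = KlHom.toFun f (numPt T n i) := by
  rw [pt_eq]
  exact KlHom.comp_pure_left _ _ f

theorem caseNum_toFun {X : Kl T} : ∀ (n : ℕ) (f : Fin n → (𝟙_ (Kl T) ⟶ X)) (i : Fin n),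
    KlHom.toFun (caseNum n f) (numPt T n i) = KlHom.toFun (f i) ()
  | 0, _, i => i.elim0
  | n + 1, f, i => by
    refine Fin.lastCases ?_ (fun i => ?_) i
    · rw [numPt_last]; rfl
    · rw [numPt_castSucc]
      exact caseNum_toFun n _ i

theorem num_hom_ext {X : Kl T} {n : ℕ} {f g : num (Kl T) n ⟶ X}
    (h : ∀ i, KlHom.toFun f (numPt T n i) = KlHom.toFun g (numPt T n i)) : f = g :=
  KlHom.ext (funext fun x => by
    obtain ⟨i, rfl⟩ := (numPt_bijective n).2 x
    exact h i)

/-! ### Measures on numerals as probability vectors -/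

/-- The mass of a point of a numeral. -/
def mass {n : ℕ} (μ : Prob (num (Kl T) n).obj) (j : Fin n) : ℝ≥0∞ :=
  μ.toFun (trivEvent (num_trivial n) {numPt T n j})

/-- A numeral has finitely many points and the trivial action, so integration is a finite sum and a
measure is determined by its point masses. -/
theorem int_num {n : ℕ} (μ : Prob (num (Kl T) n).obj) (φ : (num (Kl T) n).obj → ℝ≥0∞) :
    μ.int φ = ∑ j, φ (numPt T n j) * mass μ j := by
  let _ : Fintype (num (Kl T) n).obj := Fintype.ofEquiv _ (numEquiv T n)
  rw [Prob.int_trivial (num_trivial n)]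
  exact ((numEquiv T n).sum_comp _).symm

theorem num_fs {n : ℕ} (φ : (num (Kl T) n).obj → ℝ≥0∞) : FS φ :=
  ⟨∅, fun σ _ x => by rw [num_trivial]⟩

theorem prob_num_ext {n : ℕ} {μ ν : Prob (num (Kl T) n).obj} (h : ∀ j, mass μ j = mass ν j) :
    μ = ν :=
  Prob.ext_int fun φ _ => by simp only [int_num, h]

theorem sum_mass {n : ℕ} (μ : Prob (num (Kl T) n).obj) : ∑ j, mass μ j = 1 := by
  have := int_num μ fun _ => 1
  rw [μ.int_const] at this
  simpa using this.symm

theorem mass_ne_top {n : ℕ} (μ : Prob (num (Kl T) n).obj) (j : Fin n) : mass μ j ≠ ∞ :=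
  ne_top_of_le_ne_top ENNReal.one_ne_top
    (sum_mass μ ▸ Finset.single_le_sum (fun _ _ => zero_le) (Finset.mem_univ j))

theorem mass_dirac {n : ℕ} (i j : Fin n) : mass (dirac (numPt T n i)) j = if i = j then 1 else 0 := by
  change Set.indicator {numPt T n j} 1 (numPt T n i) = _
  simp [Set.indicator_apply, (numPt_bijective n).1.eq_iff]

/-- The integral defining Kleisli composition is a finite sum over the middle numeral; this is the
rule of matrix multiplication. -/
theorem mass_comp {l m n : ℕ} (f : num (Kl T) l ⟶ num (Kl T) m) (g : num (Kl T) m ⟶ num (Kl T) n)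
    (x : (num (Kl T) l).obj) (j : Fin n) : mass (KlHom.toFun (f ≫ g) x) j =
      ∑ k, mass (KlHom.toFun f x) k * mass (KlHom.toFun g (numPt T m k)) j := by
  refine (int_num (KlHom.toFun f x) fun y => mass (KlHom.toFun g y) j).trans ?_
  exact Finset.sum_congr rfl fun k _ => mul_comm _ _

theorem mulNum_toFun (m n : ℕ) (k : Fin (m * n)) :
    KlHom.toFun (mulNum (Kl T) m n) (numPt T (m * n) k) =
      dirac (X := prod (num (Kl T) m).obj (num (Kl T) n).obj)
        (numPt T m (finProdFinEquiv.symm k).1, numPt T n (finProdFinEquiv.symm k).2) := by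
  rw [mulNum, caseNum_toFun, pt_eq, pt_eq]
  refine congrArg (fun f => KlHom.toFun f ()) (a₂ := KlHom.pure T (X := one G)
    (Y := prod (num (Kl T) m).obj (num (Kl T) n).obj)
    (fun _ => (numPt T m (finProdFinEquiv.symm k).1, numPt T n (finProdFinEquiv.symm k).2))
    fun σ _ => Prod.ext (num_trivial m σ _).symm (num_trivial n σ _).symm) ?_
  simp only [Kl.comp_def, MonoidalCategoryStruct.tensorHom, MonoidalCategoryStruct.leftUnitor,
    Kl.iso, MonoidalCategoryStruct.tensorUnit, MonoidalCategoryStruct.tensorObj,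
    KlHom.pure_tensor, KlHom.pure_comp]

/-- `h` is known only through the commuting square, so the square is tested on a product of two
point indicators. One side is then the product of the masses; on the other, `mulNum` is Dirac-valued
and injective on points, and only the index `j` survives. -/
theorem mass_tensor {m n m' n' : ℕ} (f : num (Kl T) m ⟶ num (Kl T) n)
    (g : num (Kl T) m' ⟶ num (Kl T) n') (h : num (Kl T) (m * m') ⟶ num (Kl T) (n * n'))
    (hh : mulNum (Kl T) m m' ≫ (f ⊗ₘ g) = h ≫ mulNum (Kl T) n n') (i : Fin (m * m'))
    (j : Fin (n * n')) : mass (KlHom.toFun h (numPt T _ i)) j =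
      mass (KlHom.toFun f (numPt T m (finProdFinEquiv.symm i).1)) (finProdFinEquiv.symm j).1 *
      mass (KlHom.toFun g (numPt T m' (finProdFinEquiv.symm i).2)) (finProdFinEquiv.symm j).2 := by
  let φ₁ : (num (Kl T) n).obj → ℝ≥0∞ :=
    Set.indicator {numPt T n (finProdFinEquiv.symm j).1} 1
  let φ₂ : (num (Kl T) n').obj → ℝ≥0∞ :=
    Set.indicator {numPt T n' (finProdFinEquiv.symm j).2} 1
  let φ : prod (num (Kl T) n).obj (num (Kl T) n').obj → ℝ≥0∞ := fun p => φ₁ p.1 * φ₂ p.2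
  have hφ : FS φ := ⟨∅, fun σ _ p => by
    have : σ • p = p := Prod.ext (num_trivial n σ _) (num_trivial n' σ _)
    rw [this]⟩
  have key := congrArg (fun u => (KlHom.toFun u (numPt T _ i)).int φ) hh
  have e1 : (KlHom.toFun (mulNum (Kl T) m m' ≫ (f ⊗ₘ g)) (numPt T _ i)).int φ =
      mass (KlHom.toFun f (numPt T m (finProdFinEquiv.symm i).1)) (finProdFinEquiv.symm j).1 *
      mass (KlHom.toFun g (numPt T m' (finProdFinEquiv.symm i).2)) (finProdFinEquiv.symm j).2 := by
    refine (KlHom.comp_int _ _ _ hφ).trans ?_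
    rw [mulNum_toFun]
    refine (int_dirac (X := prod (num (Kl T) m).obj (num (Kl T) m').obj) _
      (KlHom.fs (f ⊗ₘ g) hφ)).trans ?_
    refine (KlHom.tensor_int f g _ hφ).trans ?_
    simp_rw [φ, Prob.int_const_mul _ _ (num_fs φ₂), mul_comm (φ₁ _),
      Prob.int_const_mul _ _ (num_fs φ₁)]
    rw [mul_comm]
    exact congrArg₂ (· * ·) (Prob.int_indicator _ (trivEvent (num_trivial n) _))
      (Prob.int_indicator _ (trivEvent (num_trivial n') _))
  have e2 : (KlHom.toFun (h ≫ mulNum (Kl T) n n') (numPt T _ i)).int φ =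
      mass (KlHom.toFun h (numPt T _ i)) j := by
    refine (KlHom.comp_int _ _ _ hφ).trans ?_
    rw [int_num, Finset.sum_eq_single j]
    · rw [mulNum_toFun, int_dirac _ hφ]
      simp [φ, φ₁, φ₂]
    · intro k _ hk
      rw [mulNum_toFun, int_dirac _ hφ]
      refine mul_eq_zero_of_left ?_ _
      simp only [φ, φ₁, φ₂, Set.indicator_apply, Set.mem_singleton_iff,
        (numPt_bijective _).1.eq_iff, mul_eq_zero]
      by_contra hcon
      push Not at hcon
      refine hk (finProdFinEquiv.symm.injective (Prod.ext ?_ ?_))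
      · by_contra h'; exact hcon.1 (if_neg h')
      · by_contra h'; exact hcon.2 (if_neg h')
    · exact fun h => absurd (Finset.mem_univ j) h
  exact e2.symm.trans (key.symm.trans e1)

theorem of_addCases_left {m m' n : ℕ} (A : Matrix (Fin m) (Fin n) ℝ) (B : Matrix (Fin m') (Fin n) ℝ)
    (i : Fin m) (j : Fin n) : Matrix.of (Fin.addCases A B) (Fin.castAdd m' i) j = A i j :=
  congrFun (Fin.addCases_left (motive := fun _ => Fin n → ℝ) (left := A) (right := B) i) j

theorem of_addCases_right {m m' n : ℕ} (A : Matrix (Fin m) (Fin n) ℝ)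
    (B : Matrix (Fin m') (Fin n) ℝ) (i : Fin m') (j : Fin n) :
    Matrix.of (Fin.addCases A B) (Fin.natAdd m i) j = B i j :=
  congrFun (Fin.addCases_right (motive := fun _ => Fin n → ℝ) (left := A) (right := B) i) j

/-- The Bernoulli base of the Kleisli category of a commutative submonad. -/
def bernoulliBase (T : StrongSubmonad G) [T.IsCommutative] : BernoulliBase (Kl T) where
  map {m _} f := Matrix.of fun i j => (mass (KlHom.toFun f (numPt T m i)) j).toReal
  nonneg _ _ _ := ENNReal.toReal_nonneg
  row_sum f i := by
    simp only [Matrix.of_apply]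
    rw [← ENNReal.toReal_sum fun j _ => mass_ne_top _ j, sum_mass, ENNReal.toReal_one]
  map_id n := by
    ext i j
    refine (congrArg ENNReal.toReal (mass_dirac i j)).trans ?_
    rw [Matrix.one_apply]
    split_ifs <;> simp
  map_comp f g := by
    ext i j
    simp only [Matrix.of_apply, Matrix.mul_apply, mass_comp]
    rw [ENNReal.toReal_sum fun k _ => ENNReal.mul_ne_top (mass_ne_top _ k) (mass_ne_top _ j)]
    simp only [ENNReal.toReal_mul]
  map_ofFun u := by
    ext i j
    simp only [Matrix.of_apply, ofFun, caseNum_toFun, pt_toFun, mass_dirac]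
    split_ifs <;> simp
  map_copair f g := by
    ext i j
    refine Fin.addCases (fun i => ?_) (fun i => ?_) i
    · rw [of_addCases_left]
      simp only [Matrix.of_apply, copairNum, caseNum_toFun, Fin.addCases_left, pt_comp_toFun]
    · rw [of_addCases_right]
      simp only [Matrix.of_apply, copairNum, caseNum_toFun, Fin.addCases_right, pt_comp_toFun]
  map_tensor f g h hh := by
    ext i j
    simp only [Matrix.of_apply, Matrix.submatrix_apply, Matrix.kroneckerMap_apply,
      mass_tensor f g h hh, ENNReal.toReal_mul]
  -- The masses are finite, so no information is lost in passing to real numbers.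
  faithful f g h := num_hom_ext fun i => prob_num_ext fun j =>
    (ENNReal.toReal_eq_toReal_iff' (mass_ne_top _ _) (mass_ne_top _ _)).1 (congrFun₂ h i j)

/-- Dirac measures separate the points of a numeral, so the event in question is the singleton of
the `j`-th point. -/
theorem isStandard_bernoulliBase : IsStandard (bernoulliBase T) := by
  intro m n f i j S hS
  rw [pt_comp_toFun]
  refine congrArg (fun S => ((KlHom.toFun f (numPt T m i)).toFun S).toReal) (Subtype.ext ?_)
  rw [hS]
  ext y
  rw [Set.mem_ofPred_eq, pt_toFun, dirac_eq_iff (num_trivial n)]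
  rfl

end

/-! ### Morphisms with a deterministic value at a point -/

/-- The value of `f` at `x` is the Dirac measure of `y`. -/
def Det {X Y : Kl T} (f : X ⟶ Y) (x : X.obj) (y : Y.obj) : Prop := KlHom.toFun f x = dirac y

/-- The left unit law at a single point: only the value at `x` has to be Dirac, and no equivariant
function inducing `f` is required. -/
theorem Det.comp_toFun {X Y Z : Kl T} {f : X ⟶ Y} {x : X.obj} {y : Y.obj} (h : Det f x y)
    (g : Y ⟶ Z) : KlHom.toFun (f ≫ g) x = KlHom.toFun g y :=
  Prob.ext_int fun φ hφ => by
    refine (KlHom.comp_int f g x hφ).trans ?_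
    rw [show KlHom.toFun f x = dirac y from h, int_dirac _ (KlHom.fs g hφ)]

theorem Det.comp {X Y Z : Kl T} {f : X ⟶ Y} {g : Y ⟶ Z} {x : X.obj} {y : Y.obj} {z : Z.obj}
    (hf : Det f x y) (hg : Det g y z) : Det (f ≫ g) x z := (hf.comp_toFun g).trans hg

theorem Det.tensor {X Y X' Y' : Kl T} {f : X ⟶ Y} {g : X' ⟶ Y'} {x : X.obj} {x' : X'.obj}
    {y : Y.obj} {y' : Y'.obj} (hf : Det f x y) (hg : Det g x' y') :
    Det (f ⊗ₘ g) ((x, x') : prod X.obj X'.obj) ((y, y') : prod Y.obj Y'.obj) :=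
  Prob.ext_int fun φ hφ => by
    refine (KlHom.tensor_int f g (x, x') hφ).trans ?_
    rw [show KlHom.toFun f x = dirac y from hf, show KlHom.toFun g x' = dirac y' from hg,
      int_dirac _ (FS.int_snd (X := Y.obj) (Y := Y'.obj) hφ _),
      int_dirac _ (FS.curry (X := Y.obj) (Y := Y'.obj) hφ _)]
    exact (int_dirac (X := prod Y.obj Y'.obj) (y, y') hφ).symm

theorem det_id (X : Kl T) (x : X.obj) : Det (𝟙 X) x x := rfl

theorem hom_ext_det {X Y : Kl T} {f g : X ⟶ Y} (u : X.obj → Y.obj) (hf : ∀ x, Det f x (u x))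
    (hg : ∀ x, Det g x (u x)) : f = g :=
  KlHom.ext (funext fun x => (hf x).trans (hg x).symm)

/-! ### Laws of morphisms into finite objects -/

section

variable [T.IsCommutative]

/-- Between trivial actions every bijection is equivariant, so an enumeration of `ι` makes `X`
isomorphic to a numeral. The isomorphism is the case map of the points, and its inverse merely
relabels outcomes. -/
theorem bernoulliBase_isLaw {X : Kl T} (hX : ∀ (σ : GAut G) (x : X.obj), σ • x = x) {ι : Type*}
    [Fintype ι] (p : ι ≃ X.obj) (pts : ι → (𝟙_ (Kl T) ⟶ X))
    (hpts : ∀ i, KlHom.toFun (pts i) () = dirac (p i)) (f : 𝟙_ (Kl T) ⟶ X) :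
    (bernoulliBase T).IsLaw pts f fun i =>
      ((KlHom.toFun f ()).toFun (trivEvent hX {p i})).toReal := by
  let e := Fintype.equivFin ι
  let N := Fintype.card ι
  let q : (num (Kl T) N).obj ≃ X.obj := (numEquiv T N).symm.trans (e.symm.trans p)
  let i : num (Kl T) N ≅ X := Kl.iso q q.symm
    (fun σ x => by rw [num_trivial, hX]) (fun σ x => by rw [num_trivial, hX])
    q.symm_apply_apply q.apply_symm_apply
  have hq : ∀ k, q (numPt T N k) = p (e.symm k) := fun k =>
    congrArg (fun k => p (e.symm k)) ((numEquiv T N).symm_apply_apply k)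
  have hc : (caseNum N fun k => pts (e.symm k)) = i.hom := num_hom_ext fun k => by
    rw [caseNum_toFun, hpts]
    exact congrArg dirac (hq k).symm
  have hiso : IsIso (caseNum N fun k => pts (e.symm k)) := hc ▸ inferInstance
  refine ⟨N, e, hiso, fun a => ?_⟩
  have hinv : inv (caseNum N fun k => pts (e.symm k)) = i.inv :=
    IsIso.inv_eq_of_hom_inv_id (by rw [hc, i.hom_inv_id])
  rw [hinv]
  refine congrArg ENNReal.toReal ?_
  -- The numeral 1 is `0 + 1` and not the monoidal unit itself; discarding compares the two.
  have h1 : KlHom.toFun (ε[num (Kl T) 1] ≫ f ≫ i.inv) (numPt T 1 0) = KlHom.toFun (f ≫ i.inv) () :=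
    congrFun (KlHom.pure_comp_left (Y := one G) _ _ (f ≫ i.inv)) _
  rw [h1]
  refine Eq.trans ?_ (Prob.int_indicator _ _)
  change (KlHom.toFun f ()).int (fun x => mass (dirac (q.symm x)) (e a)) = _
  congr 1
  funext x
  change Set.indicator {numPt T N (e a)} 1 (q.symm x) = Set.indicator {p a} 1 x
  have : q.symm x = numPt T N (e a) ↔ x = p a := by
    rw [Equiv.symm_apply_eq, hq, e.symm_apply_apply]
  simp only [Set.indicator_apply, Set.mem_singleton_iff, this]
  rfl

/-! ### Evaluation of terms -/

theorem det_copy (X : Kl T) (x : X.obj) : Det Δ[X] x ((x, x) : prod X.obj X.obj) := rfl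

theorem det_discard (X : Kl T) (x : X.obj) : Det ε[X] x () := rfl

variable (M : GraphModel (Kl T))

theorem det_var_here {Γ : List Ty} {A : Ty} (γ : (M.ctx Γ).obj) (a : (M.ty A).obj) :
    Det (M.var (Var.here (Γ := Γ) (A := A))) ((γ, a) : prod (M.ctx Γ).obj (M.ty A).obj) a :=
  ((det_discard _ γ).tensor (det_id _ a)).comp (Y := 𝟙_ (Kl T) ⊗ M.ty A) rfl

theorem det_var_there {Γ : List Ty} {A B : Ty} {x : Var Γ A} {γ : (M.ctx Γ).obj}
    {a : (M.ty A).obj} (h : Det (M.var x) γ a) (b : (M.ty B).obj) :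
    Det (M.var (Var.there (B := B) x)) ((γ, b) : prod (M.ctx Γ).obj (M.ty B).obj) a :=
  Det.comp (Y := M.ctx Γ ⊗ 𝟙_ (Kl T)) ((det_id _ γ).tensor (det_discard _ b))
    (Det.comp (Y := M.ctx Γ) (y := γ) rfl h)

theorem det_pair {Γ : List Ty} {A B : Ty} {t : Tm Γ A} {u : Tm Γ B} {γ : (M.ctx Γ).obj}
    {a : (M.ty A).obj} {b : (M.ty B).obj} (ht : Det (M.tm t) γ a) (hu : Det (M.tm u) γ b) :
    Det (M.tm (.pair t u)) γ ((a, b) : prod (M.ty A).obj (M.ty B).obj) :=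
  (det_copy _ γ).comp (ht.tensor hu)

/-! ### Points of the types of truth values, tuples and matrices -/

/-- The points of `bool`. -/
def boolPt (b : Bool) : two G := if b then Sum.inr () else Sum.inl ()

theorem det_boolLit {Γ : List Ty} (b : Bool) (γ : (M.ctx Γ).obj) :
    Det (M.tm (boolLit (Γ := Γ) b)) γ (boolPt (G := G) b) := by
  cases b
  · exact (det_discard _ γ).comp (Y := 𝟙_ (Kl T)) rfl
  · exact (det_discard _ γ).comp (Y := 𝟙_ (Kl T)) rfl

/-- Tuples of points. -/
def tuplePt {A : Ty} : (n : ℕ) → (Fin n → (M.ty A).obj) → (M.ty (A.pow n)).obj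
  | 0, _ => ()
  | n + 1, f => ((f 0, tuplePt n fun i => f i.succ) : prod (M.ty A).obj (M.ty (A.pow n)).obj)

theorem det_tuple {Γ : List Ty} {A : Ty} {γ : (M.ctx Γ).obj} : ∀ (n : ℕ) {f : Fin n → Tm Γ A}
    {a : Fin n → (M.ty A).obj} (_ : ∀ i, Det (M.tm (f i)) γ (a i)),
    Det (M.tm (tuple n f)) γ (tuplePt M n a)
  | 0, _, _, _ => det_discard _ γ
  | n + 1, _, _, h => det_pair M (h 0) (det_tuple n fun i => h i.succ)

theorem tuplePt_bijective {A : Ty} : ∀ n, Function.Bijective (tuplePt M (A := A) n)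
  | 0 => ⟨fun f g _ => funext fun i => i.elim0, fun x => ⟨fun i => i.elim0, rfl⟩⟩
  | n + 1 => by
    obtain ⟨h1, h2⟩ := tuplePt_bijective (A := A) n
    constructor
    · intro f g h
      have h' : ((f 0, tuplePt M n fun i => f i.succ) : prod (M.ty A).obj (M.ty (A.pow n)).obj) =
        (g 0, tuplePt M n fun i => g i.succ) := h
      rw [Prod.mk.injEq] at h'
      funext i
      refine Fin.cases h'.1 (fun i => ?_) i
      exact congrFun (h1 h'.2) i
    · rintro ⟨a, x⟩
      obtain ⟨f, rfl⟩ := h2 x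
      exact ⟨Fin.cons a f, rfl⟩

theorem pow_trivial {A : Ty} (hA : ∀ (σ : GAut G) (x : (M.ty A).obj), σ • x = x) :
    ∀ (n : ℕ) (σ : GAut G) (x : (M.ty (A.pow n)).obj), σ • x = x
  | 0, _, _ => rfl
  | n + 1, σ, x => Prod.ext (hA σ x.1) (pow_trivial hA n σ x.2)

theorem bool_trivial (σ : GAut G) (x : (M.ty .bool).obj) : σ • x = x := two_trivial σ x

theorem boolPt_bijective : Function.Bijective (boolPt (G := G)) := by
  constructor
  · rintro (_ | _) (_ | _) h
    · rfl
    · exact nomatch h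
    · exact nomatch h
    · rfl
  · rintro (x | x)
    · exact ⟨false, rfl⟩
    · exact ⟨true, rfl⟩

/-- Matrices of truth values, as points. -/
def matrixPt (n : ℕ) (a : Fin n → Fin n → Bool) : (M.ty ((Ty.bool.pow n).pow n)).obj :=
  tuplePt M n fun i => tuplePt M (A := .bool) n fun j => boolPt (G := G) (a i j)

theorem matrixPt_bijective (n : ℕ) : Function.Bijective (matrixPt M n) := by
  refine (tuplePt_bijective M n).comp (Function.Bijective.comp_left (α := Fin n)
    (g := fun r : Fin n → Bool => tuplePt M (A := .bool) n fun j => boolPt (G := G) (r j)) ?_)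
  exact (tuplePt_bijective M n).comp (Function.Bijective.comp_left boolPt_bijective)

theorem det_matrix {Γ : List Ty} {γ : (M.ctx Γ).obj} (n : ℕ) {f : Fin n → Fin n → Tm Γ .bool}
    {a : Fin n → Fin n → Bool}
    (h : ∀ i j, Det (M.tm (f i j)) γ (boolPt (G := G) (a i j))) :
    Det (M.tm (matrix n f)) γ (matrixPt M n a) :=
  det_tuple M n fun i => det_tuple M n fun j => h i j

/-- The evaluation rule for a term whose value is random: copying is Dirac on the diagonal, so the
bound value is integrated out with the environment held fixed. -/
theorem tm_letIn_int {Γ : List Ty} {A B : Ty} (t : Tm Γ A) (u : Tm (A :: Γ) B) (γ : (M.ctx Γ).obj)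
    {φ : (M.ty B).obj → ℝ≥0∞} (hφ : FS φ) : (KlHom.toFun (M.tm (.letIn t u)) γ).int φ =
      (KlHom.toFun (M.tm t) γ).int fun a =>
        (KlHom.toFun (M.tm u) ((γ, a) : prod (M.ctx Γ).obj (M.ty A).obj)).int φ := by
  have h := (det_copy _ γ).comp_toFun (M.ctx Γ ◁ M.tm t ≫ M.tm u)
  refine (congrArg (fun μ => Prob.int μ φ) h).trans ?_
  refine (KlHom.comp_int _ _ _ hφ).trans ?_
  have hF : FS (X := prod (M.ctx Γ).obj (M.ty A).obj) fun p => (KlHom.toFun (M.tm u) p).int φ :=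
    KlHom.fs (M.tm u) hφ
  refine (KlHom.tensor_int _ _ _ hF).trans ?_
  exact KlHom.pure_int _ _ _ (hF.int_snd _)

end

/-! ### Adjacency matrices of tuples of vertices sampled from `ν_α` -/

/-- The adjacency matrix of a tuple of vertices. -/
def adjMatrix (G : SimpleGraph V) {n : ℕ} (x : Fin n → V) (i j : Fin n) : Bool :=
  decide (G.Adj (x i) (x j))

/-- Iterated integration of a function of `n` vertices. -/
def iterInt (ν : Prob (vertices G)) : (n : ℕ) → ((Fin n → V) → ℝ≥0∞) → ℝ≥0∞
  | 0, ψ => ψ Fin.elim0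
  | n + 1, ψ => iterInt ν n fun x => ν.int fun v => ψ (Fin.snoc (α := fun _ => V) x v)

/-- Invariance of a function of tuples of vertices. -/
def Invariant (G : SimpleGraph V) {n : ℕ} (ψ : (Fin n → V) → ℝ≥0∞) : Prop :=
  ∀ (σ : GAut G) (x : Fin n → V), ψ (fun i => σ (x i)) = ψ x

theorem map_snoc (σ : GAut G) {n : ℕ} (x : Fin n → V) (v : V) :
    (fun i => σ (Fin.snoc (α := fun _ => V) x v i)) =
      Fin.snoc (α := fun _ => V) (fun i => σ (x i)) (σ v) := by
  funext i
  refine Fin.lastCases ?_ (fun i => ?_) i <;> simp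

/-- Once the first `n` vertices are held fixed, invariance of `ψ` becomes support by those vertices.
-/
theorem Invariant.snoc {n : ℕ} {ψ : (Fin (n + 1) → V) → ℝ≥0∞} (h : Invariant G ψ) (x : Fin n → V)
    (σ : GAut G) (hσ : Fixes σ (Finset.univ.image x)) (v : V) :
    ψ (Fin.snoc (α := fun _ => V) x (σ v)) = ψ (Fin.snoc (α := fun _ => V) x v) := by
  rw [← h σ (Fin.snoc (α := fun _ => V) x v), map_snoc]
  congr 2
  exact funext fun i => (hσ _ (Finset.mem_image_of_mem x (Finset.mem_univ i))).symm

theorem Invariant.fs {n : ℕ} {ψ : (Fin (n + 1) → V) → ℝ≥0∞} (h : Invariant G ψ) (x : Fin n → V) :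
    FS (X := vertices G) fun v => ψ (Fin.snoc (α := fun _ => V) x v) :=
  ⟨Finset.univ.image x, fun σ hσ v => h.snoc x σ hσ v⟩

/-- Change of variables in an invariant measure. It keeps the hypothesis of invariance available
through inductions on the number of vertices. -/
theorem Invariant.int {n : ℕ} {ψ : (Fin (n + 1) → V) → ℝ≥0∞} (h : Invariant G ψ)
    {ν : Prob (vertices G)} (hν : ∀ σ : GAut G, σ • ν = ν) :
    Invariant G fun x : Fin n → V => ν.int fun v => ψ (Fin.snoc (α := fun _ => V) x v) :=
  fun σ x => by
    change ν.int (fun v => ψ (Fin.snoc (α := fun _ => V) (fun i => σ (x i)) v)) = _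
    conv_lhs => rw [← hν σ]
    rw [Prob.smul_int _ _ (h.fs _)]
    congr 1
    funext v
    rw [← h σ (Fin.snoc (α := fun _ => V) x v), map_snoc]
    rfl

theorem Invariant.const_mul {n : ℕ} {ψ : (Fin n → V) → ℝ≥0∞} (h : Invariant G ψ) (c : ℝ≥0∞) :
    Invariant G fun x => c * ψ x := fun σ x => congrArg (c * ·) (h σ x)

theorem iterInt_const_mul {ν : Prob (vertices G)} (hν : ∀ σ : GAut G, σ • ν = ν) (c : ℝ≥0∞) :
    ∀ (n : ℕ) {ψ : (Fin n → V) → ℝ≥0∞}, Invariant G ψ →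
      iterInt ν n (fun x => c * ψ x) = c * iterInt ν n ψ
  | 0, _, _ => rfl
  | n + 1, ψ, h => by
    simp only [iterInt]
    rw [← iterInt_const_mul hν c n (h.int hν)]
    congr 1
    exact funext fun x => Prob.int_const_mul ν c (h.fs x)

/-- Almost surely, vertices sampled from `ν_α` are distinct. -/
theorem iterInt_congr (hG : IsRado G) (α : unitInterval) : ∀ (n : ℕ) {ψ ψ' : (Fin n → V) → ℝ≥0∞},
    Invariant G ψ → Invariant G ψ' → (∀ x, Function.Injective x → ψ x = ψ' x) →
      iterInt (erdosRenyi hG α) n ψ = iterInt (erdosRenyi hG α) n ψ'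
  | 0, _, _, _, _, h => h _ fun i => i.elim0
  | n + 1, ψ, ψ', hψ, hψ', h => by
    have hν := (isErdosRenyi_erdosRenyi hG α).equivariant
    refine iterInt_congr hG α n (hψ.int hν) (hψ'.int hν) fun x hx => ?_
    -- Expanding over the set of earlier vertices, every witness lies outside that set, so only
    -- injective extensions of `x` are evaluated.
    rw [int_erdosRenyi hG α (hψ.snoc x), int_erdosRenyi hG α (hψ'.snoc x)]
    refine Finset.sum_congr rfl fun B _ => ?_
    refine congrArg (weight α _ B * ·) (h _ ?_)
    refine Fin.snoc_injective_of_injective hx ?_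
    rintro ⟨i, hi⟩
    exact hG.wit_notMem _ B (hi ▸ Finset.mem_image_of_mem x (Finset.mem_univ i))

/-! ### The law of the adjacency matrix -/

/-- The indicator of the tuples with a given adjacency matrix. -/
def matrixInd (G : SimpleGraph V) {n : ℕ} (a : Fin n → Fin n → Bool) (x : Fin n → V) : ℝ≥0∞ :=
  if adjMatrix G x = a then 1 else 0

theorem matrixInd_invariant {n : ℕ} (a : Fin n → Fin n → Bool) : Invariant G (matrixInd G a) :=
  fun σ x => by
    have : adjMatrix G (fun i => σ (x i)) = adjMatrix G x := by
      funext i j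
      exact decide_eq_decide.2 σ.map_rel_iff
    rw [matrixInd, this]; rfl

/-- The matrix is the adjacency matrix of a simple graph. -/
def IsSimpleMatrix {n : ℕ} (a : Fin n → Fin n → Bool) : Prop :=
  (∀ i, a i i = false) ∧ ∀ i j, a i j = a j i

/-- The probability of a truth value of an edge. -/
def edgeWeight (α : unitInterval) (b : Bool) : ℝ≥0∞ :=
  if b then ENNReal.ofReal α else ENNReal.ofReal (1 - α)

/-- Separates what concerns the old vertices, what concerns the new vertex, and a condition on `a`
alone, so that integrating over the new vertex yields a factor depending only on `a`. -/
theorem adjMatrix_snoc_eq_iff {n : ℕ} (a : Fin (n + 1) → Fin (n + 1) → Bool) (x : Fin n → V)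
    (v : V) : adjMatrix G (Fin.snoc (α := fun _ => V) x v) = a ↔
      adjMatrix G x = (fun i j => a i.castSucc j.castSucc) ∧
      (∀ i, decide (G.Adj v (x i)) = a i.castSucc (Fin.last n)) ∧
      (a (Fin.last n) (Fin.last n) = false ∧
        ∀ i : Fin n, a i.castSucc (Fin.last n) = a (Fin.last n) i.castSucc) := by
  simp only [funext_iff, Fin.forall_fin_succ', adjMatrix, Fin.snoc_castSucc, Fin.snoc_last,
    SimpleGraph.irrefl, G.adj_comm v]
  constructor
  · rintro ⟨h1, h2, h3⟩
    exact ⟨fun i => (h1 i).1, fun i => (h1 i).2, by simpa using h3.symm,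
      fun i => ((h1 i).2.symm.trans (h2 i))⟩
  · rintro ⟨h1, h2, h3, h4⟩
    exact ⟨fun i => ⟨h1 i, h2 i⟩, fun i => (h2 i).trans (h4 i), by simp [h3]⟩

/-- For distinct old vertices, prescribing all adjacencies of the new one selects exactly one type
over their set. Injectivity of `x` rules out conflicting prescriptions and turns the weight, a
product over vertices, into a product over indices. -/
theorem int_matrixInd_snoc (hG : IsRado G) (α : unitInterval) {n : ℕ}
    (a : Fin (n + 1) → Fin (n + 1) → Bool) {x : Fin n → V} (hx : Function.Injective x) :
    (erdosRenyi hG α).int (fun v => matrixInd G a (Fin.snoc (α := fun _ => V) x v)) =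
      (if a (Fin.last n) (Fin.last n) = false ∧
          ∀ i : Fin n, a i.castSucc (Fin.last n) = a (Fin.last n) i.castSucc then
        ∏ i : Fin n, edgeWeight α (a i.castSucc (Fin.last n)) else 0) *
      matrixInd G (fun i j => a i.castSucc j.castSucc) x := by
  rw [int_erdosRenyi hG α ((matrixInd_invariant a).snoc x), expect]
  simp only [matrixInd, adjMatrix_snoc_eq_iff]
  by_cases h : a (Fin.last n) (Fin.last n) = false ∧
      ∀ i : Fin n, a i.castSucc (Fin.last n) = a (Fin.last n) i.castSucc
  swap
  · rw [if_neg h, zero_mul]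
    exact Finset.sum_eq_zero fun B _ => by rw [if_neg fun h' => h h'.2.2, mul_zero]
  by_cases h' : adjMatrix G x = fun i j => a i.castSucc j.castSucc
  swap
  · rw [if_neg h', mul_zero]
    exact Finset.sum_eq_zero fun B _ => by rw [if_neg fun h'' => h' h''.1, mul_zero]
  rw [if_pos h, if_pos h', mul_one]
  -- The only neighbour set compatible with the last column of `a`.
  let B₀ := (Finset.univ.filter fun i => a i.castSucc (Fin.last n) = true).image x
  have hmem : ∀ i, x i ∈ Finset.univ.image x := fun i =>
    Finset.mem_image_of_mem x (Finset.mem_univ i)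
  have hB₀ : ∀ i, x i ∈ B₀ ↔ a i.castSucc (Fin.last n) = true := fun i => by
    simp [B₀, hx.eq_iff]
  rw [Finset.sum_eq_single B₀]
  · rw [if_pos, mul_one, weight, Finset.prod_image fun _ _ _ _ h => hx h]
    · simp only [hB₀, edgeWeight]
    · refine ⟨h', fun i => ?_, h⟩
      rw [Bool.eq_iff_iff, decide_eq_true_iff, hG.adj_wit _ (hmem i), hB₀]
  · intro B hB hne
    rw [if_neg, mul_zero]
    rintro ⟨-, hB', -⟩
    have hBi : ∀ i, x i ∈ B ↔ x i ∈ B₀ := fun i => by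
      rw [hB₀, ← hB' i, decide_eq_true_iff, hG.adj_wit _ (hmem i)]
    refine hne (Finset.ext fun v => ⟨fun hv => ?_, fun hv => ?_⟩)
    · obtain ⟨i, -, rfl⟩ := Finset.mem_image.1 (Finset.mem_powerset.1 hB hv)
      exact (hBi i).1 hv
    · obtain ⟨i, -, rfl⟩ := Finset.mem_image.1 hv
      exact (hBi i).2 hv
  · intro hB
    exact absurd (Finset.mem_powerset.2 (Finset.image_subset_image (Finset.filter_subset _ _))) hB

/-- Each new vertex contributes the edge weights of the last column and tests the last diagonal
entry and the symmetry of the last row and column. The product is arranged column by column to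
follow this recursion. -/
theorem iterInt_matrixInd (hG : IsRado G) (α : unitInterval) :
    ∀ (n : ℕ) (a : Fin n → Fin n → Bool), iterInt (erdosRenyi hG α) n (matrixInd G a) =
      if IsSimpleMatrix a then ∏ j, ∏ i, if i < j then edgeWeight α (a i j) else 1 else 0
  | 0, a => by
    have h : IsSimpleMatrix a := ⟨fun i => i.elim0, fun i => i.elim0⟩
    rw [if_pos h, iterInt, matrixInd, if_pos (Subsingleton.elim _ _)]
    simp
  | n + 1, a => by
    have hν := (isErdosRenyi_erdosRenyi hG α).equivariant
    have hinv := matrixInd_invariant (G := G) fun i j : Fin n => a i.castSucc j.castSucc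
    -- The one-vertex formula is available for distinct vertices only, which suffices because
    -- coincidences have measure zero.
    rw [iterInt, iterInt_congr hG α n ((matrixInd_invariant a).int hν) (hinv.const_mul _)
      fun x hx => int_matrixInd_snoc hG α a hx, iterInt_const_mul hν _ n hinv,
      iterInt_matrixInd hG α n]
    have hs : IsSimpleMatrix a ↔ (a (Fin.last n) (Fin.last n) = false ∧
        ∀ i : Fin n, a i.castSucc (Fin.last n) = a (Fin.last n) i.castSucc) ∧
        IsSimpleMatrix fun i j : Fin n => a i.castSucc j.castSucc := by
      simp only [IsSimpleMatrix, Fin.forall_fin_succ']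
      constructor
      · rintro ⟨⟨h1, h2⟩, h3, h4, -⟩
        exact ⟨⟨h2, fun i => (h3 i).2⟩, h1, fun i j => (h3 i).1 j⟩
      · rintro ⟨⟨h2, h3⟩, h1, h4⟩
        exact ⟨⟨h1, h2⟩, fun i => ⟨fun j => h4 i j, h3 i⟩, fun i => (h3 i).symm, trivial⟩
    by_cases h1 : a (Fin.last n) (Fin.last n) = false ∧
        ∀ i : Fin n, a i.castSucc (Fin.last n) = a (Fin.last n) i.castSucc
    swap
    · rw [if_neg h1, if_neg fun h => h1 (hs.1 h).1, zero_mul]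
    by_cases h2 : IsSimpleMatrix fun i j : Fin n => a i.castSucc j.castSucc
    swap
    · rw [if_neg h2, if_neg fun h => h2 (hs.1 h).2, mul_zero]
    rw [if_pos h1, if_pos h2, if_pos (hs.2 ⟨h1, h2⟩), Fin.prod_univ_castSucc]
    simp only [Fin.prod_univ_castSucc, Fin.castSucc_lt_castSucc_iff, Fin.castSucc_lt_last,
      if_true, lt_irrefl, if_false, mul_one, (Fin.castSucc_lt_last _).not_gt]
    rw [mul_comm]

/-- The graphon is constant, so the integrand is constant on a space of total mass 1. -/
theorem matrixLaw_erdosRenyi (α : unitInterval) {n : ℕ} (a : Fin n → Fin n → Bool) :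
    (Graphon.erdosRenyi α).matrixLaw n a = ENNReal.toReal
      (if IsSimpleMatrix a then ∏ j, ∏ i, if i < j then edgeWeight α (a i j) else 1 else 0) := by
  have hlaw : (Graphon.erdosRenyi α).matrixLaw n a = if IsSimpleMatrix a then
      (Graphon.erdosRenyi α).graphProb n (SimpleGraph.fromRel fun i j => a i j = true) else 0 := by
    rw [Graphon.matrixLaw]
    exact if_congr Iff.rfl rfl rfl
  rw [hlaw]
  by_cases h : IsSimpleMatrix a
  swap
  · rw [if_neg h, if_neg h, ENNReal.toReal_zero]
  rw [if_pos h, if_pos h, Graphon.graphProb]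
  simp only [Graphon.erdosRenyi]
  rw [integral_const, probReal_univ, one_smul, Finset.prod_filter, Fintype.prod_prod_type,
    Finset.prod_comm, ENNReal.toReal_prod]
  refine Finset.prod_congr rfl fun j _ => ?_
  rw [ENNReal.toReal_prod]
  refine Finset.prod_congr rfl fun i _ => ?_
  by_cases hij : i < j
  -- `SimpleGraph.fromRel` symmetrises the relation and removes the diagonal; for a symmetric matrix
  -- and `i < j` this changes nothing.
  · rw [if_pos hij, if_pos hij, SimpleGraph.fromRel_adj, h.2 j i, or_self, edgeWeight,
      apply_ite ENNReal.toReal, ENNReal.toReal_ofReal α.2.1,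
      ENNReal.toReal_ofReal (sub_nonneg.2 α.2.2)]
    simp only [ne_eq, hij.ne, not_false_eq_true, true_and]
  · rw [if_neg hij, if_neg hij, ENNReal.toReal_one]

/-! ### The random graphs -/

section

variable {α : unitInterval} {ν : Prob (vertices G)} (hν : IsErdosRenyi G α ν)
  [(erMonad ν).IsCommutative]

theorem det_edge (v w : V) : Det (radoModel hν).edge
    ((v, w) : prod (vertices G) (vertices G)) (boolPt (G := G) (decide (G.Adj v w))) := by
  refine congrArg dirac ?_
  by_cases h : G.Adj v w <;> simp [boolPt, h]

theorem det_edge_pair {Γ : List Ty} {x y : Var Γ .vertex} {γ : ((radoModel hν).ctx Γ).obj} {v w : V}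
    (hx : Det ((radoModel hν).var x) γ v) (hy : Det ((radoModel hν).var y) γ w) :
    Det ((radoModel hν).tm (.edge (.pair (.var x) (.var y)))) γ
      (boolPt (G := G) (decide (G.Adj v w))) :=
  (det_pair (radoModel hν) (t := .var x) (u := .var y) hx hy).comp (det_edge hν v w)

/-- All terms involved are Dirac-valued at every environment, so the equations reduce to
irreflexivity and symmetry of adjacency. -/
theorem radoModel_isSimpleUndirected : (radoModel hν).IsSimpleUndirected where
  irrefl := by
    refine hom_ext_det (fun _ => boolPt (G := G) false) (fun γ => ?_) (det_boolLit _ false)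
    obtain ⟨u, v⟩ := γ
    have hx := det_var_here (radoModel hν) (Γ := []) (A := .vertex) u v
    have := det_edge_pair hν hx hx
    rwa [decide_eq_false (G.loopless.irrefl v)] at this
  symm := by
    refine hom_ext_det (fun γ : prod (prod (one G) (vertices G)) (vertices G) =>
      boolPt (G := G) (decide (G.Adj γ.1.2 γ.2))) ?_ ?_
    · rintro ⟨⟨u, v⟩, w⟩
      exact det_edge_pair hν (det_var_there _ (det_var_here (radoModel hν) (Γ := []) u v) w)
        (det_var_here (radoModel hν) (Γ := [.vertex]) (u, v) w)
    · rintro ⟨⟨u, v⟩, w⟩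
      have := det_edge_pair hν (det_var_here (radoModel hν) (Γ := [.vertex]) (u, v) w)
        (det_var_there _ (det_var_here (radoModel hν) (Γ := []) u v) w)
      simpa only [G.adj_comm w v] using this
  deterministic := by
    have hu : Equivariant (X := prod (vertices G) (vertices G)) (Y := two G) fun p =>
        boolPt (G := G) (decide (G.Adj p.1 p.2)) := fun σ p => by
      rw [two_trivial]
      exact congrArg boolPt (decide_eq_decide.2 σ.map_rel_iff)
    have : (radoModel hν).edge = KlHom.pure (erMonad ν) _ hu :=
      hom_ext_det (fun p : prod (vertices G) (vertices G) =>
        boolPt (G := G) (decide (G.Adj p.1 p.2))) (fun p => det_edge hν p.1 p.2) fun _ => rfl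
    rw [this]
    exact KlHom.pure_deterministic (X := ⟨prod (vertices G) (vertices G)⟩) (Y := ⟨two G⟩) _ hu

/-! ### Evaluation of the graph program -/

theorem vertexVar_last (n : ℕ) : vertexVar (n + 1) (Fin.last n) = Var.here :=
  Fin.lastCases_last (motive := fun _ => Var (List.replicate (n + 1) Ty.vertex) Ty.vertex)

theorem vertexVar_castSucc (n : ℕ) (i : Fin n) :
    vertexVar (n + 1) i.castSucc = Var.there (vertexVar n i) :=
  Fin.lastCases_castSucc (motive := fun _ => Var (List.replicate (n + 1) Ty.vertex) Ty.vertex) i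

/-- A tuple of vertices, as a valuation of a context. -/
def valuation : (n : ℕ) → (Fin n → V) → ((radoModel hν).ctx (List.replicate n Ty.vertex)).obj
  | 0, _ => ()
  | n + 1, x => ((valuation n fun i => x i.castSucc, x (Fin.last n)) :
      prod ((radoModel hν).ctx (List.replicate n Ty.vertex)).obj (vertices G))

theorem valuation_snoc (n : ℕ) (x : Fin n → V) (v : V) :
    valuation hν (n + 1) (Fin.snoc (α := fun _ => V) x v) = ((valuation hν n x, v) :
      prod ((radoModel hν).ctx (List.replicate n Ty.vertex)).obj (vertices G)) :=
  Prod.ext (congrArg (valuation hν n) (funext fun i => Fin.snoc_castSucc (α := fun _ => V) v x i))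
    (Fin.snoc_last (α := fun _ => V) v x)

theorem det_vertexVar : ∀ (n : ℕ) (x : Fin n → V) (i : Fin n),
    Det ((radoModel hν).var (vertexVar n i)) (valuation hν n x) (x i)
  | 0, _, i => i.elim0
  | n + 1, x, i => by
    refine Fin.lastCases ?_ (fun i => ?_) i
    · rw [vertexVar_last]
      exact det_var_here (radoModel hν) (Γ := List.replicate n .vertex) (A := .vertex) _ _
    · rw [vertexVar_castSucc]
      exact det_var_there (radoModel hν) (det_vertexVar n _ i) _

/-- In `letNew` the last vertex is bound innermost, matching the recursion of `iterInt`, which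
integrates out the last coordinate first. -/
theorem tm_letNew_int {B : Ty} {φ : ((radoModel hν).ty B).obj → ℝ≥0∞} (hφ : FS φ) :
    ∀ (n : ℕ) (t : Tm (List.replicate n Ty.vertex) B),
      (KlHom.toFun ((radoModel hν).tm (letNew n t)) ()).int φ =
        iterInt ν n fun x => (KlHom.toFun ((radoModel hν).tm t) (valuation hν n x)).int φ
  | 0, t => rfl
  | n + 1, t => by
    rw [letNew, tm_letNew_int hφ n, iterInt]
    congr 1
    funext x
    refine (tm_letIn_int (radoModel hν) _ t _ hφ).trans ?_
    have h : KlHom.toFun ((radoModel hν).tm (.new .unit)) (valuation hν n x) = ν :=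
      (det_discard _ _).comp_toFun (Y := 𝟙_ (Kl (erMonad ν))) (radoModel hν).new
    rw [h]
    refine congrArg ν.int (funext fun v => ?_)
    exact congrArg (fun γ => (KlHom.toFun ((radoModel hν).tm t) γ).int φ)
      (valuation_snoc hν n x v).symm

/-- After the vertices are drawn the program returns their adjacency matrix with certainty, so the
mass of a matrix is the iterated integral of an indicator. -/
theorem graphProgram_mass (n : ℕ) (a : Fin n → Fin n → Bool)
    (S : Event ((radoModel hν).ty ((Ty.bool.pow n).pow n)).obj)
    (hS : S.1 = {matrixPt (radoModel hν) n a}) :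
    (KlHom.toFun ((radoModel hν).tm (graphProgram n)) ()).toFun S =
      iterInt ν n (matrixInd G a) := by
  rw [← Prob.int_indicator, graphProgram, tm_letNew_int hν (FS.indicator S)]
  congr 1
  funext x
  have h : Det ((radoModel hν).tm (matrix n fun i j =>
      .edge (.pair (.var (vertexVar n i)) (.var (vertexVar n j))))) (valuation hν n x)
      (matrixPt (radoModel hν) n (adjMatrix G x)) :=
    det_matrix _ n fun i j => det_edge_pair hν (det_vertexVar hν n x i) (det_vertexVar hν n x j)
  rw [show KlHom.toFun _ _ = dirac _ from h, int_dirac _ (FS.indicator S), hS]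
  simp only [Set.indicator_apply, Set.mem_singleton_iff, (matrixPt_bijective _ n).1.eq_iff,
    matrixInd, Pi.one_apply]

end

theorem radoModel_hasRandomGraphs (hG : IsRado G) (α : unitInterval)
    [(erMonad (erdosRenyi hG α)).IsCommutative] :
    (radoModel (isErdosRenyi_erdosRenyi hG α)).HasRandomGraphs (bernoulliBase _)
      (Graphon.erdosRenyi α).matrixLaw := by
  intro n
  let M := radoModel (isErdosRenyi_erdosRenyi hG α)
  have h := bernoulliBase_isLaw (X := M.ty ((Ty.bool.pow n).pow n))
    (pow_trivial M (pow_trivial M (bool_trivial M) n) n)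
    (Equiv.ofBijective _ (matrixPt_bijective M n))
    (fun a => M.tm (matrix (Γ := []) n fun i j => boolLit (a i j)))
    (fun a => det_matrix M (Γ := []) n fun i j => det_boolLit M (Γ := []) (a i j) ()) (M.tm (graphProgram n))
  refine (congrArg (BernoulliBase.IsLaw _ _ _) (funext fun a => ?_)).mp h
  rw [matrixLaw_erdosRenyi, ← iterInt_matrixInd hG α]
  exact congrArg ENNReal.toReal (graphProgram_mass _ n a _ rfl)

end

end RadoNominal

theorem corollary6p10 {V : Type} (G : SimpleGraph V) (hG : RadoNominal.IsRado G)
    (α : unitInterval) :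
    ∃ (ν : RadoNominal.Prob (RadoNominal.vertices G)) (hν : RadoNominal.IsErdosRenyi G α ν)
      (_ : (RadoNominal.erMonad ν).IsCommutative),
      (RadoNominal.radoModel hν).IsSimpleUndirected ∧
      ∃ Ψ : BernoulliBase (RadoNominal.Kl (RadoNominal.erMonad ν)),
        RadoNominal.IsStandard Ψ ∧
        (RadoNominal.radoModel hν).HasRandomGraphs Ψ (Graphon.erdosRenyi α).matrixLaw :=
  have hc := RadoNominal.erMonad_isCommutative hG α
  ⟨RadoNominal.erdosRenyi hG α, RadoNominal.isErdosRenyi_erdosRenyi hG α, hc,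
    RadoNominal.radoModel_isSimpleUndirected _, RadoNominal.bernoulliBase _,
    RadoNominal.isStandard_bernoulliBase, RadoNominal.radoModel_hasRandomGraphs hG α⟩
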